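/- **Bipass.** A *strip* is a finite (possibly empty) row of black and white stones in which every stone is *alive*: every black stone has a white stone somewhere to its right, and every white stone has a black stone somewhere to its left. A move interchanges a black stone with a white stone lying to its right; Left may do so only if there is no black stone between the two, and Right only if there is no white stone between them. After a move all dead (not alive) stones are removed. A *bipass sum* $g=g_1+\dots+g_n$ ($n\ge 0$) is a disjunctive sum of strips, played under normal play (a player who cannot move loses). For a strip $s$ let $\Delta(s)$ be the number of white stones minus the number of black stones on $s$, and let $\Delta(g)=\sum_i\Delta(g_i)$. **Atomic weight.** Games are short (finite) normal-play games, $o$ denotes the outcome, and $G\equiv H$ means that $o(G+X)=o(H+X)$ for all games $X$. The far star $☆$ is the (non-short) game from which both players can move to any nim-heap $*k$, $k\ge 0$; $G=_{☆}H$ means that $o(G+X+☆)=o(H+X+☆)$ for all games $X$. Let $*=\{0\mid 0\}$, $\uparrow=\{0\mid *\}$, $\downarrow=\{*\mid 0\}$. If $G\equiv n$ for an integer $n$, then $G\cdot{\uparrow}$ is the sum of $n$ copies of $\uparrow$ (of $-n$ copies of $\downarrow$ if $n<0$); otherwise $$G\cdot{\uparrow}=\{\,G^{L}\cdot{\uparrow}+{\uparrow}+{\uparrow}+{*}\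 \mid\ G^{R}\cdot{\uparrow}+{\downarrow}+{\downarrow}+{*}\,\},$$ where $G^L$, $G^R$ range over the Left and Right options of $G$. A game is *all-small* if in it and in each of its followers either both players have a move or neither has. The *atomic weight* $\mathrm{aw}(g)$ of an all-small game $g$ is the game $G$, unique up to $\equiv$, with $G\cdot{\uparrow}=_{☆}g$. **Theorem.** Every bipass sum $g$ is an all-small game that has an atomic weight (in particular, the game $G$ above exists and is unique up to $\equiv$), and $$\mathrm{aw}(g)=\Delta(g).$$ In particular, the atomic weight of every bipass sum is an integer, and every integer is the atomic weight of some bipass strip. -/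

import Mathlib

noncomputable section

namespace CGT

/-! ### Normal-play games -/

/-- Loopfree partizan games: a game is given by its families of Left and Right options. -/
inductive Game : Type 1
  | mk (α β : Type) (L : α → Game) (R : β → Game) : Game

namespace Game

/-- The game `0`, in which nobody can move. -/
instance : Zero Game := ⟨mk Empty Empty Empty.elim Empty.elim⟩

/-- The disjunctive sum: a player moves in exactly one of the two components. -/
def add (x y : Game) : Game :=
  Game.rec (motive := fun _ => Game → Game)
    (fun α β _ _ addL addR y =>
      Game.rec (motive := fun _ => Game)
        (fun α' β' L' R' xAddL' xAddR' =>
          mk (α ⊕ α') (β ⊕ β')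
            (Sum.elim (fun i => addL i (mk α' β' L' R')) xAddL')
            (Sum.elim (fun j => addR j (mk α' β' L' R')) xAddR'))
        y)
    x y

instance : Add Game := ⟨add⟩

theorem mk_add_mk (α β α' β' : Type) (L : α → Game) (R : β → Game)
    (L' : α' → Game) (R' : β' → Game) :
    mk α β L R + mk α' β' L' R' =
      mk (α ⊕ α') (β ⊕ β')
        (Sum.elim (fun i => L i + mk α' β' L' R') (fun i => mk α β L R + L' i))
        (Sum.elim (fun j => R j + mk α' β' L' R') (fun j => mk α β L R + R' j)) :=
  rfl

/-- A game is short if it and all its followers have finitely many options. -/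
def IsShort : Game → Prop
  | mk α β L R => Finite α ∧ Finite β ∧ (∀ i, IsShort (L i)) ∧ (∀ j, IsShort (R j))

/-- A game is all-small if in it and in all its followers either both players
have a move or neither has. -/
def IsAllSmall : Game → Prop
  | mk α β L R => (Nonempty α ↔ Nonempty β) ∧ (∀ i, IsAllSmall (L i)) ∧ (∀ j, IsAllSmall (R j))

/-! Normal play: a player who cannot move loses. -/

mutual
/-- Left, moving first, can force a win. -/
def LeftWinsFirst : Game → Prop
  | mk _ _ L _ => ∃ i, LeftWinsSecond (L i)
/-- Left can force a win when Right moves first. -/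
def LeftWinsSecond : Game → Prop
  | mk _ _ _ R => ∀ j, LeftWinsFirst (R j)
end

/-- The four outcome classes. -/
inductive Outcome
  /-- Left wins independently of who starts. -/
  | left
  /-- The current (next) player wins. -/
  | next
  /-- The previous player wins. -/
  | previous
  /-- Right wins independently of who starts. -/
  | right

open Classical in
/-- The outcome function. Play is finite, so Right wins exactly when Left does not. -/
def outcome (G : Game) : Outcome :=
  if G.LeftWinsFirst then
    if G.LeftWinsSecond then Outcome.left else Outcome.next
  else
    if G.LeftWinsSecond then Outcome.previous else Outcome.right

/-- Equality of game values: `G` and `H` have the same outcome in every context. -/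
def Equiv (G H : Game) : Prop :=
  ∀ X : Game, X.IsShort → outcome (G + X) = outcome (H + X)

/-- The nim-heap `*n`. -/
def nim (n : ℕ) : Game :=
  mk (Fin n) (Fin n) (fun i => nim i.1) (fun i => nim i.1)
termination_by n
decreasing_by all_goals exact i.2

/-- The far star: both players can move to any nim-heap. -/
def farStar : Game := mk ℕ ℕ nim nim

/-- Equivalence modulo the far star. -/
def FarStarEquiv (G H : Game) : Prop :=
  ∀ X : Game, X.IsShort → outcome (G + X + farStar) = outcome (H + X + farStar)

/-- The canonical form of a natural number: `n + 1 = {n | }`. -/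
def ofNat : ℕ → Game
  | 0 => 0
  | n + 1 => mk Unit Empty (fun _ => ofNat n) Empty.elim

/-- The canonical form of the negative of a natural number: `-(n + 1) = { | -n}`. -/
def negOfNat : ℕ → Game
  | 0 => 0
  | n + 1 => mk Empty Unit Empty.elim (fun _ => negOfNat n)

/-- The integers as games. -/
def ofInt : ℤ → Game
  | Int.ofNat n => ofNat n
  | Int.negSucc n => negOfNat (n + 1)

/-- `* = {0 | 0}`. -/
def star : Game := mk Unit Unit (fun _ => 0) (fun _ => 0)

/-- `↑ = {0 | *}`. -/
def up : Game := mk Unit Unit (fun _ => 0) (fun _ => star)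

/-- `↓ = {* | 0}`. -/
def down : Game := mk Unit Unit (fun _ => star) (fun _ => 0)

/-- The sum of `n` copies of `G`. -/
def copies (G : Game) : ℕ → Game
  | 0 => 0
  | n + 1 => G + copies G n

/-- The integer multiples of `↑`. -/
def intMulUp : ℤ → Game
  | Int.ofNat n => copies up n
  | Int.negSucc n => copies down (n + 1)

open Classical in
/-- The product `G · ↑`: the multiple `n · ↑` if `G` has the value of the integer `n`, and
`{Gᴸ · ↑ + ⇑* | Gᴿ · ↑ + ⇓*}` otherwise. -/
def mulUp : Game → Game
  | mk α β L R =>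
    if h : ∃ n : ℤ, Equiv (mk α β L R) (ofInt n) then intMulUp h.choose
    else mk α β (fun i => mulUp (L i) + (up + up + star))
      (fun j => mulUp (R j) + (down + down + star))

/-- `g.HasAtomicWeight G`: the game `g` is a (short) all-small game, and `G` is the unique (short)
game, up to equality of values, with `G · ↑` equivalent to `g` modulo the far star. -/
def HasAtomicWeight (g G : Game) : Prop :=
  g.IsShort ∧ g.IsAllSmall ∧ G.IsShort ∧ FarStarEquiv G.mulUp g ∧
    ∀ H : Game, H.IsShort → FarStarEquiv H.mulUp g → Equiv H G

end Game

/-! ### The ruleset bipass -/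

/-- The stones: black ones are Left's, white ones are Right's. -/
inductive Stone
  | black
  | white
  deriving DecidableEq

open Stone

/-- All stones of a row are alive: each black stone has a white stone somewhere to its right,
and each white stone has a black stone somewhere to its left. -/
def AllAlive (l : List Stone) : Prop :=
  (∀ a b, l = a ++ black :: b → white ∈ b) ∧ (∀ a b, l = a ++ white :: b → black ∈ a)

/-- Remove the dead stones: the white ones at the left end and the black ones at the right end. -/
def removeDead (l : List Stone) : List Stone :=
  (l.dropWhile (fun x => decide (x = white))).rdropWhile (fun x => decide (x = black))

theorem removeDead_sublist (l : List Stone) : (removeDead l).Sublist l :=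
  List.IsPrefix.sublist (List.rdropWhile_prefix _ _) |>.trans (List.dropWhile_sublist _)

theorem allAlive_removeDead (l : List Stone) : AllAlive (removeDead l) := by
  have hpre : removeDead l <+: l.dropWhile (fun x => decide (x = white)) :=
    List.rdropWhile_prefix _ _
  constructor
  · intro a b h
    have hne : removeDead l ≠ [] := by simp [h]
    have hlast := List.rdropWhile_last_not (fun x => decide (x = black))
      (l.dropWhile (fun x => decide (x = white))) hne
    have hl : (removeDead l).getLast hne = white := by
      cases hx : (removeDead l).getLast hne with
      | white => rfl
      | black => exact absurd (decide_eq_true hx) hlast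
    have hg : (a ++ black :: b).getLast (by simp) = white := by
      simpa only [h] using hl
    cases b with
    | nil => simp at hg
    | cons c b' =>
      have hc : (c :: b').getLast (by simp) = white := by
        simpa using hg
      rw [← hc]
      exact List.getLast_mem _
  · intro a b h
    obtain ⟨t, ht⟩ := hpre
    rw [h] at ht
    have hdne : l.dropWhile (fun x => decide (x = white)) ≠ [] := by rw [← ht]; simp
    have hhead := List.head_dropWhile_not (fun x => decide (x = white)) hdne
    cases a with
    | cons c a' =>
      cases c with
      | black => simp
      | white =>
        have h2 : (l.dropWhile (fun x => decide (x = white))).head hdne = white := by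
          simp [← ht]
        simp [h2] at hhead
    | nil =>
      have h2 : (l.dropWhile (fun x => decide (x = white))).head hdne = white := by
        simp [← ht]
      simp [h2] at hhead

/-- A bipass strip: a finite row of stones, all of them alive. -/
structure Strip where
  stones : List Stone
  alive : AllAlive stones

namespace Strip

/-- The strip that remains of a row of stones after the dead stones are removed. -/
def ofRow (l : List Stone) : Strip := ⟨removeDead l, allAlive_removeDead l⟩

/-- Left's moves: interchange a black stone and a white stone to its right that have no black
stone between them. -/
def LeftMove (s t : Strip) : Prop :=
  ∃ a m b, s.stones = a ++ black :: (m ++ white :: b) ∧ black ∉ m ∧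
    t = ofRow (a ++ white :: (m ++ black :: b))

/-- Right's moves: interchange a black stone and a white stone to its right that have no white
stone between them. -/
def RightMove (s t : Strip) : Prop :=
  ∃ a m b, s.stones = a ++ black :: (m ++ white :: b) ∧ white ∉ m ∧
    t = ofRow (a ++ white :: (m ++ black :: b))

/-- The number of pairs of a black stone and a white stone to its right. It drops in every move,
so that play ends. -/
def inv : List Stone → ℕ
  | [] => 0
  | black :: l => l.count white + inv l
  | white :: l => inv l

theorem inv_append (a b : List Stone) :
    inv (a ++ b) = inv a + inv b + a.count black * b.count white := by
  induction a with
  | nil => simp [inv]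
  | cons c a ih =>
    cases c
    · simp [inv, ih]; ring
    · simp [inv, ih]

theorem inv_le_of_sublist {a b : List Stone} (h : a.Sublist b) : inv a ≤ inv b := by
  induction h with
  | slnil => exact le_rfl
  | cons c _ ih => cases c <;> simp only [inv] <;> omega
  | cons_cons c h ih =>
    cases c
    · have := h.count_le white
      simp only [inv]; omega
    · simpa only [inv] using ih

theorem inv_swap_lt (a m b : List Stone) :
    inv (ofRow (a ++ white :: (m ++ black :: b))).stones <
      inv (a ++ black :: (m ++ white :: b)) := by
  refine lt_of_le_of_lt (inv_le_of_sublist (removeDead_sublist _)) ?_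
  simp only [inv_append, inv, List.count_cons, List.count_append]
  simp
  nlinarith

theorem LeftMove.inv_lt {s t : Strip} (h : LeftMove s t) : inv t.stones < inv s.stones := by
  obtain ⟨a, m, b, hs, -, rfl⟩ := h
  rw [hs]
  exact inv_swap_lt a m b

theorem RightMove.inv_lt {s t : Strip} (h : RightMove s t) : inv t.stones < inv s.stones := by
  obtain ⟨a, m, b, hs, -, rfl⟩ := h
  rw [hs]
  exact inv_swap_lt a m b

/-- The game of bipass played on one strip. -/
def toGame (s : Strip) : Game :=
  Game.mk {t : Strip // LeftMove s t} {t : Strip // RightMove s t}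
    (fun t => toGame t.1) (fun t => toGame t.1)
termination_by inv s.stones
decreasing_by
  · exact t.2.inv_lt
  · exact t.2.inv_lt

/-- The excess of white stones on a strip. -/
def excess (s : Strip) : ℤ := (s.stones.count white : ℤ) - (s.stones.count black : ℤ)

end Strip

/-- The disjunctive sum of finitely many bipass strips. -/
def bipassSum (g : List Strip) : Game := (g.map Strip.toGame).sum

/-- The `Δ`-excess of a disjunctive sum of bipass strips. -/
def bipassExcess (g : List Strip) : ℤ := (g.map Strip.excess).sum

end CGT

end

noncomputable section

namespace CGT

namespace Game

/-! ### Options and the order on games -/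

-- Games modulo equality of values form a partially ordered abelian group whose order decides
-- outcomes (`leftWins_iff`). Two short games are equivalent modulo ☆ as soon as their difference
-- lies between ↓☆ and ↑☆ (`farStarEquiv_of_zero_le`), so the heart of the matter is to place g −
-- Δ(g)·↑ in that interval. A black stone followed by two white ones is a strip of value ↑ and
-- excess 1, and the mirror image of a strip has the opposite value and excess. Hence both (g −
-- Δ(g)·↑) + ↑ and −(g − Δ(g)·↑) + ↑ are values of bipass sums of excess 1, and it suffices that
-- Left, playing second, wins g + ☆ whenever Δ(g) ≥ 1 (`bipassSum_add_farStar`).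
--
-- The excess measures Left's lead. A move by Right costs at most 1 (`RightMove.excess_le`), and
-- Left can gain 1 as long as some strip has two black stones (`exists_leftMove_excess`). Once every
-- strip has at most one, a strip with k white stones behaves like the number k, from which Left
-- subtracts any positive amount and Right exactly 1, and Left wins by parity (`zero_le_bw_sum`).
-- Left uses ☆ to correct the parity. When Right has moved ☆ to *n, the same argument needs one more
-- unit of excess (`bipassSum_add_nim`).
--
-- For uniqueness, the order relation between x and an integer k determines who wins x·↑ + m·↑ + ☆
-- for suitable m (`mulUp_bounds`), so x·↑ equivalent to n·↑ modulo ☆ forces x = n. The induction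
-- rests on the simplicity theorem for integers (`exists_val_eq_ofInt`); its integer case is again
-- the bipass result, since multiples of ↑ are bipass sums.

/-- `IsLeftOption x' x`: the game `x'` is a Left option of `x`. -/
def IsLeftOption (x' : Game) : Game → Prop
  | mk _ _ L _ => ∃ i, x' = L i

/-- `IsRightOption x' x`: the game `x'` is a Right option of `x`. -/
def IsRightOption (x' : Game) : Game → Prop
  | mk _ _ _ R => ∃ j, x' = R j

theorem option_induction {p : Game → Prop}
    (h : ∀ x, (∀ x', IsLeftOption x' x → p x') → (∀ x', IsRightOption x' x → p x') → p x)
    (x : Game) : p x := by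
  induction x with
  | mk α β L R ihL ihR =>
    refine h _ ?_ ?_
    · rintro _ ⟨i, rfl⟩; exact ihL i
    · rintro _ ⟨j, rfl⟩; exact ihR j

/-- The pair of the relations `x ≤ y` and `x ⧏ y`, defined simultaneously. -/
def leLf (x y : Game) : Prop × Prop :=
  Game.rec (motive := fun _ => Game → Prop × Prop)
    (fun _ _ _ _ leL leR y =>
      Game.rec (motive := fun _ => Prop × Prop)
        (fun α' β' L' R' leL' leR' =>
          ((∀ i, (leL i (mk α' β' L' R')).2) ∧ ∀ j, (leR' j).2,
            (∃ i, (leL' i).1) ∨ ∃ j, (leR j (mk α' β' L' R')).1))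
        y)
    x y

instance : LE Game := ⟨fun x y => (leLf x y).1⟩

/-- Games are determined, so the second relation is just the negation of the reversed first one.
From here on only `≤` and its negation are used. -/
theorem leLf_snd_iff_not_le (x y : Game) :
    ((leLf x y).2 ↔ ¬ y ≤ x) ∧ ((leLf y x).2 ↔ ¬ x ≤ y) := by
  induction x generalizing y with
  | mk α β L R ihL ihR =>
    induction y with
    | mk α' β' L' R' ihL' ihR' =>
      have key : ∀ (α β : Type) (L : α → Game) (R : β → Game) (α' β' : Type) (L' : α' → Game)
          (R' : β' → Game),
          (∀ i, (leLf (L' i) (mk α β L R)).2 ↔ ¬ mk α β L R ≤ L' i) →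
          (∀ j, (leLf (mk α' β' L' R') (R j)).2 ↔ ¬ R j ≤ mk α' β' L' R') →
          ((leLf (mk α β L R) (mk α' β' L' R')).2 ↔ ¬ mk α' β' L' R' ≤ mk α β L R) := by
        intro α β L R α' β' L' R' h1 h2
        change ((∃ i, (leLf (mk α β L R) (L' i)).1) ∨ ∃ j, (leLf (R j) (mk α' β' L' R')).1) ↔
          ¬ ((∀ i, (leLf (L' i) (mk α β L R)).2) ∧ ∀ j, (leLf (mk α' β' L' R') (R j)).2)
        simp only [h1, h2, not_and_or, not_forall, not_not]
        rfl
      exact ⟨key _ _ _ _ _ _ _ _ (fun i => (ihL' i).2) fun j => (ihR j _).2,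
        key _ _ _ _ _ _ _ _ (fun i => (ihL i _).1) fun j => (ihR' j).1⟩

theorem le_iff {x y : Game} : x ≤ y ↔
    (∀ x', IsLeftOption x' x → ¬ y ≤ x') ∧ (∀ y', IsRightOption y' y → ¬ y' ≤ x) := by
  cases x with
  | mk α β L R =>
    cases y with
    | mk α' β' L' R' =>
      change ((∀ i, (leLf (L i) (mk α' β' L' R')).2) ∧ ∀ j, (leLf (mk α β L R) (R' j)).2) ↔ _
      simp only [(leLf_snd_iff_not_le _ _).1]
      constructor
      · rintro ⟨h1, h2⟩
        exact ⟨by rintro _ ⟨i, rfl⟩; exact h1 i, by rintro _ ⟨j, rfl⟩; exact h2 j⟩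
      · rintro ⟨h1, h2⟩
        exact ⟨fun i => h1 _ ⟨i, rfl⟩, fun j => h2 _ ⟨j, rfl⟩⟩

theorem IsLeftOption.not_le {x' x : Game} (h : IsLeftOption x' x) {y : Game} (hy : x ≤ y) :
    ¬ y ≤ x' := (le_iff.1 hy).1 _ h

theorem IsRightOption.not_le {x' x : Game} (h : IsRightOption x' x) {y : Game} (hy : y ≤ x) :
    ¬ x' ≤ y := (le_iff.1 hy).2 _ h

theorem game_le_refl (x : Game) : x ≤ x := by
  induction x using option_induction with
  | h x ihL ihR =>
    refine le_iff.2 ⟨fun x' hx' h => ?_, fun x' hx' h => ?_⟩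
    · exact hx'.not_le h (ihL _ hx')
    · exact hx'.not_le h (ihR _ hx')

/-- Replacing one of the three games by an option rotates the roles in the transitivity statement,
so all three rotations are carried through the induction. -/
theorem game_le_trans_cyclic (x y z : Game) :
    (x ≤ y → y ≤ z → x ≤ z) ∧ (y ≤ z → z ≤ x → y ≤ x) ∧ (z ≤ x → x ≤ y → z ≤ y) := by
  induction x using option_induction generalizing y z with
  | h x xL xR =>
  induction y using option_induction generalizing z with
  | h y yL yR =>
  induction z using option_induction with
  | h z zL zR =>
  refine ⟨fun h1 h2 => le_iff.2 ⟨fun x' hx' h => ?_, fun x' hx' h => ?_⟩,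
    fun h1 h2 => le_iff.2 ⟨fun x' hx' h => ?_, fun x' hx' h => ?_⟩,
    fun h1 h2 => le_iff.2 ⟨fun x' hx' h => ?_, fun x' hx' h => ?_⟩⟩
  · exact hx'.not_le h1 ((xL _ hx' y z).2.1 h2 h)
  · exact hx'.not_le h2 ((zR _ hx').2.2 h h1)
  · exact hx'.not_le h1 ((yL _ hx' z).2.2 h2 h)
  · exact hx'.not_le h2 ((xR _ hx' y z).1 h h1)
  · exact hx'.not_le h1 ((zL _ hx').1 h2 h)
  · exact hx'.not_le h2 ((yR _ hx' z).2.1 h h1)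

instance : Preorder Game where
  le_refl := game_le_refl
  le_trans x y z := (game_le_trans_cyclic x y z).1

/-! ### Addition and negation -/

theorem isLeftOption_add {x y z : Game} : IsLeftOption z (x + y) ↔
    (∃ x', IsLeftOption x' x ∧ z = x' + y) ∨ ∃ y', IsLeftOption y' y ∧ z = x + y' := by
  cases x with
  | mk α β L R =>
    cases y with
    | mk α' β' L' R' =>
      rw [mk_add_mk]
      constructor
      · rintro ⟨i | i, rfl⟩
        · exact Or.inl ⟨_, ⟨i, rfl⟩, rfl⟩
        · exact Or.inr ⟨_, ⟨i, rfl⟩, rfl⟩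
      · rintro (⟨_, ⟨i, rfl⟩, rfl⟩ | ⟨_, ⟨i, rfl⟩, rfl⟩)
        · exact ⟨Sum.inl i, rfl⟩
        · exact ⟨Sum.inr i, rfl⟩

theorem isRightOption_add {x y z : Game} : IsRightOption z (x + y) ↔
    (∃ x', IsRightOption x' x ∧ z = x' + y) ∨ ∃ y', IsRightOption y' y ∧ z = x + y' := by
  cases x with
  | mk α β L R =>
    cases y with
    | mk α' β' L' R' =>
      rw [mk_add_mk]
      constructor
      · rintro ⟨i | i, rfl⟩
        · exact Or.inl ⟨_, ⟨i, rfl⟩, rfl⟩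
        · exact Or.inr ⟨_, ⟨i, rfl⟩, rfl⟩
      · rintro (⟨_, ⟨i, rfl⟩, rfl⟩ | ⟨_, ⟨i, rfl⟩, rfl⟩)
        · exact ⟨Sum.inl i, rfl⟩
        · exact ⟨Sum.inr i, rfl⟩

theorem IsLeftOption.add_right {x' x : Game} (h : IsLeftOption x' x) (y : Game) :
    IsLeftOption (x' + y) (x + y) := isLeftOption_add.2 (Or.inl ⟨_, h, rfl⟩)

theorem IsLeftOption.add_left {x' x : Game} (h : IsLeftOption x' x) (y : Game) :
    IsLeftOption (y + x') (y + x) := isLeftOption_add.2 (Or.inr ⟨_, h, rfl⟩)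

theorem IsRightOption.add_right {x' x : Game} (h : IsRightOption x' x) (y : Game) :
    IsRightOption (x' + y) (x + y) := isRightOption_add.2 (Or.inl ⟨_, h, rfl⟩)

theorem IsRightOption.add_left {x' x : Game} (h : IsRightOption x' x) (y : Game) :
    IsRightOption (y + x') (y + x) := isRightOption_add.2 (Or.inr ⟨_, h, rfl⟩)

theorem not_isLeftOption_zero (x : Game) : ¬ IsLeftOption x 0 := by rintro ⟨⟨⟩, -⟩

theorem not_isRightOption_zero (x : Game) : ¬ IsRightOption x 0 := by rintro ⟨⟨⟩, -⟩

/-- The negative of a game, with the roles of the players interchanged. -/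
def neg : Game → Game
  | mk α β L R => mk β α (fun j => neg (R j)) (fun i => neg (L i))

instance : Neg Game := ⟨neg⟩

theorem neg_mk (α β : Type) (L : α → Game) (R : β → Game) :
    -mk α β L R = mk β α (fun j => -R j) (fun i => -L i) := rfl

theorem game_neg_neg (x : Game) : - -x = x := by
  induction x with
  | mk α β L R ihL ihR => simp only [neg_mk, ihL, ihR]

theorem isLeftOption_neg {x z : Game} : IsLeftOption z (-x) ↔ IsRightOption (-z) x := by
  cases x with
  | mk α β L R =>
    constructor
    · rintro ⟨j, rfl⟩; exact ⟨j, game_neg_neg _⟩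
    · rintro ⟨j, h⟩; exact ⟨j, (game_neg_neg z).symm.trans (congrArg Neg.neg h)⟩

theorem isRightOption_neg {x z : Game} : IsRightOption z (-x) ↔ IsLeftOption (-z) x := by
  cases x with
  | mk α β L R =>
    constructor
    · rintro ⟨j, rfl⟩; exact ⟨j, game_neg_neg _⟩
    · rintro ⟨j, h⟩; exact ⟨j, (game_neg_neg z).symm.trans (congrArg Neg.neg h)⟩

theorem add_right_le_of_options {x y z : Game}
    (h1 : ∀ x', IsLeftOption x' x → ¬ y ≤ x' → ¬ y + z ≤ x' + z)
    (h2 : ∀ y', IsRightOption y' y → ¬ y' ≤ x → ¬ y' + z ≤ x + z)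
    (h3 : ∀ z', IsLeftOption z' z → x ≤ y → x + z' ≤ y + z')
    (h4 : ∀ z', IsRightOption z' z → x ≤ y → x + z' ≤ y + z') (h : x ≤ y) :
    x + z ≤ y + z := by
  refine le_iff.2 ⟨fun a ha => ?_, fun a ha => ?_⟩
  · rcases isLeftOption_add.1 ha with ⟨x', hx', rfl⟩ | ⟨z', hz', rfl⟩
    · exact h1 _ hx' (hx'.not_le h)
    · exact fun hc => (hz'.add_left y).not_le hc (h3 _ hz' h)
  · rcases isRightOption_add.1 ha with ⟨y', hy', rfl⟩ | ⟨z', hz', rfl⟩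
    · exact h2 _ hy' (hy'.not_le h)
    · exact fun hc => (hz'.add_left x).not_le hc (h4 _ hz' h)

theorem not_add_right_le_of_options {x y z : Game}
    (h1 : ∀ y', IsLeftOption y' y → x ≤ y' → x + z ≤ y' + z)
    (h2 : ∀ x', IsRightOption x' x → x' ≤ y → x' + z ≤ y + z) (h : ¬ y ≤ x) :
    ¬ y + z ≤ x + z := by
  rw [le_iff, not_and_or] at h
  push Not at h
  intro hc
  rcases h with ⟨y', hy', h⟩ | ⟨x', hx', h⟩
  · exact (hy'.add_right z).not_le hc (h1 _ hy' h)
  · exact (hx'.add_right z).not_le hc (h2 _ hx' h)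

/-- Passing to an option of `x` or `y` turns an inequality into a negated one and back, so
preservation of `≤` and of its negation have to be proved together. -/
theorem add_le_add_right_game (x y z : Game) :
    ((x ≤ y → x + z ≤ y + z) ∧ (y ≤ x → y + z ≤ x + z)) ∧
      (¬ x ≤ y → ¬ x + z ≤ y + z) ∧ (¬ y ≤ x → ¬ y + z ≤ x + z) := by
  induction x using option_induction generalizing y z with
  | h x xL xR =>
  induction y using option_induction generalizing z with
  | h y yL yR =>
  induction z using option_induction with
  | h z zL zR =>
  exact ⟨⟨add_right_le_of_options (fun _ h => (xL _ h _ _).2.2) (fun _ h => (yR _ h _).2.2)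
      (fun _ h => (zL _ h).1.1) (fun _ h => (zR _ h).1.1),
    add_right_le_of_options (fun _ h => (yL _ h _).2.1) (fun _ h => (xR _ h _ _).2.1)
      (fun _ h => (zL _ h).1.2) (fun _ h => (zR _ h).1.2)⟩,
    not_add_right_le_of_options (fun _ h => (xL _ h _ _).1.2) (fun _ h => (yR _ h _).1.2),
    not_add_right_le_of_options (fun _ h => (yL _ h _).1.1) (fun _ h => (xR _ h _ _).1.1)⟩

theorem game_add_comm_le (x y : Game) : x + y ≤ y + x := by
  induction x using option_induction generalizing y with
  | h x xL xR =>
  induction y using option_induction with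
  | h y yL yR =>
  refine le_iff.2 ⟨fun a ha h => ?_, fun a ha h => ?_⟩
  · rcases isLeftOption_add.1 ha with ⟨x', hx', rfl⟩ | ⟨y', hy', rfl⟩
    · exact (hx'.add_left y).not_le h (xL _ hx' y)
    · exact (hy'.add_right x).not_le h (yL _ hy')
  · rcases isRightOption_add.1 ha with ⟨x', hx', rfl⟩ | ⟨y', hy', rfl⟩
    · exact (hx'.add_left x).not_le h (yR _ hx')
    · exact (hy'.add_right y).not_le h (xR _ hy' y)

theorem game_add_assoc_le (x y z : Game) :
    x + y + z ≤ x + (y + z) ∧ x + (y + z) ≤ x + y + z := by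
  induction x using option_induction generalizing y z with
  | h x xL xR =>
  induction y using option_induction generalizing z with
  | h y yL yR =>
  induction z using option_induction with
  | h z zL zR =>
  refine ⟨le_iff.2 ⟨fun a ha h => ?_, fun a ha h => ?_⟩,
    le_iff.2 ⟨fun a ha h => ?_, fun a ha h => ?_⟩⟩
  · rcases isLeftOption_add.1 ha with ⟨b, hb, rfl⟩ | ⟨z', hz', rfl⟩
    · rcases isLeftOption_add.1 hb with ⟨x', hx', rfl⟩ | ⟨y', hy', rfl⟩
      · exact (hx'.add_right _).not_le h (xL _ hx' _ _).1
      · exact ((hy'.add_right _).add_left _).not_le h (yL _ hy' _).1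
    · exact ((hz'.add_left _).add_left _).not_le h (zL _ hz').1
  · rcases isRightOption_add.1 ha with ⟨x', hx', rfl⟩ | ⟨b, hb, rfl⟩
    · exact ((hx'.add_right _).add_right _).not_le h (xR _ hx' _ _).1
    · rcases isRightOption_add.1 hb with ⟨y', hy', rfl⟩ | ⟨z', hz', rfl⟩
      · exact ((hy'.add_left _).add_right _).not_le h (yR _ hy' _).1
      · exact (hz'.add_left _).not_le h (zR _ hz').1
  · rcases isLeftOption_add.1 ha with ⟨x', hx', rfl⟩ | ⟨b, hb, rfl⟩
    · exact ((hx'.add_right _).add_right _).not_le h (xL _ hx' _ _).2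
    · rcases isLeftOption_add.1 hb with ⟨y', hy', rfl⟩ | ⟨z', hz', rfl⟩
      · exact ((hy'.add_left _).add_right _).not_le h (yL _ hy' _).2
      · exact (hz'.add_left _).not_le h (zL _ hz').2
  · rcases isRightOption_add.1 ha with ⟨b, hb, rfl⟩ | ⟨z', hz', rfl⟩
    · rcases isRightOption_add.1 hb with ⟨x', hx', rfl⟩ | ⟨y', hy', rfl⟩
      · exact (hx'.add_right _).not_le h (xR _ hx' _ _).2
      · exact ((hy'.add_right _).add_left _).not_le h (yR _ hy' _).2
    · exact ((hz'.add_left _).add_left _).not_le h (zR _ hz').2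

theorem game_zero_add_le (x : Game) : 0 + x ≤ x ∧ x ≤ 0 + x := by
  induction x using option_induction with
  | h x xL xR =>
  refine ⟨le_iff.2 ⟨fun a ha h => ?_, fun a ha h => ?_⟩,
    le_iff.2 ⟨fun a ha h => ?_, fun a ha h => ?_⟩⟩
  · rcases isLeftOption_add.1 ha with ⟨b, hb, rfl⟩ | ⟨x', hx', rfl⟩
    · exact not_isLeftOption_zero _ hb
    · exact hx'.not_le h (xL _ hx').1
  · exact (ha.add_left 0).not_le h (xR _ ha).1
  · exact (ha.add_left 0).not_le h (xL _ ha).2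
  · rcases isRightOption_add.1 ha with ⟨b, hb, rfl⟩ | ⟨x', hx', rfl⟩
    · exact not_isRightOption_zero _ hb
    · exact hx'.not_le h (xR _ hx').2

theorem game_neg_le_neg_iff (x y : Game) : (-y ≤ -x ↔ x ≤ y) ∧ (-x ≤ -y ↔ y ≤ x) := by
  have expand : ∀ x y : Game, -y ≤ -x ↔
      (∀ x', IsLeftOption x' x → ¬ -x' ≤ -y) ∧ ∀ y', IsRightOption y' y → ¬ -x ≤ -y' := by
    intro x y
    rw [le_iff, and_comm]
    refine and_congr ⟨fun h x' hx' => h _ ?_, fun h a ha => ?_⟩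
      ⟨fun h y' hy' => h _ ?_, fun h a ha => ?_⟩
    · rwa [isRightOption_neg, game_neg_neg]
    · simpa only [game_neg_neg] using h _ (isRightOption_neg.1 ha)
    · rwa [isLeftOption_neg, game_neg_neg]
    · simpa only [game_neg_neg] using h _ (isLeftOption_neg.1 ha)
  induction x using option_induction generalizing y with
  | h x xL xR =>
  induction y using option_induction with
  | h y yL yR =>
  constructor
  · rw [expand, le_iff]
    exact and_congr (forall₂_congr fun x' hx' => not_congr (xL _ hx' y).2)
      (forall₂_congr fun y' hy' => not_congr (yR _ hy').2)
  · rw [expand, le_iff]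
    exact and_congr (forall₂_congr fun x' hx' => not_congr (yL _ hx').1)
      (forall₂_congr fun y' hy' => not_congr (xR _ hy' y).1)

theorem game_add_neg_le (x : Game) : x + -x ≤ 0 ∧ 0 ≤ x + -x := by
  induction x using option_induction with
  | h x xL xR =>
  refine ⟨le_iff.2 ⟨fun a ha h => ?_, fun a ha => (not_isRightOption_zero _ ha).elim⟩,
    le_iff.2 ⟨fun a ha => (not_isLeftOption_zero _ ha).elim, fun a ha h => ?_⟩⟩
  · rcases isLeftOption_add.1 ha with ⟨x', hx', rfl⟩ | ⟨x', hx', rfl⟩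
    · refine ((isRightOption_neg.2 ?_ : IsRightOption (-x') (-x)).add_left x').not_le h
        (xL _ hx').1
      rwa [game_neg_neg]
    · rw [isLeftOption_neg] at hx'
      refine (hx'.add_right x').not_le h ?_
      simpa only [game_neg_neg] using (xR _ hx').1
  · rcases isRightOption_add.1 ha with ⟨x', hx', rfl⟩ | ⟨x', hx', rfl⟩
    · refine ((isLeftOption_neg.2 ?_ : IsLeftOption (-x') (-x)).add_left x').not_le h
        (xR _ hx').2
      rwa [game_neg_neg]
    · rw [isRightOption_neg] at hx'
      refine (hx'.add_right x').not_le h ?_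
      simpa only [game_neg_neg] using (xL _ hx').2

/-! ### The group of game values -/

/-- The values of games: games up to equality of values. -/
def Value : Type 1 := Antisymmetrization Game (· ≤ ·)

namespace Value

instance : PartialOrder Value := inferInstanceAs (PartialOrder (Antisymmetrization Game (· ≤ ·)))

end Value

/-- The value of a game. -/
def val (x : Game) : Value := toAntisymmetrization (· ≤ ·) x

theorem val_le_val {x y : Game} : val x ≤ val y ↔ x ≤ y := Iff.rfl

theorem val_eq_val {x y : Game} : val x = val y ↔ x ≤ y ∧ y ≤ x := by
  rw [← val_le_val, ← val_le_val, le_antisymm_iff]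

theorem val_surjective : Function.Surjective val := Quotient.exists_rep

theorem game_add_le_add {x x' y y' : Game} (h : x ≤ x') (h' : y ≤ y') : x + y ≤ x' + y' :=
  ((add_le_add_right_game x x' y).1.1 h).trans <| (game_add_comm_le _ _).trans <|
    ((add_le_add_right_game y y' x').1.1 h').trans (game_add_comm_le _ _)

namespace Value

instance : Zero Value := ⟨val 0⟩

instance : Add Value :=
  ⟨Quotient.map₂ (· + ·) fun _ _ h _ _ h' =>
    ⟨game_add_le_add h.1 h'.1, game_add_le_add h.2 h'.2⟩⟩

instance : Neg Value :=
  ⟨Quotient.map (- ·) fun _ _ h =>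
    ⟨(game_neg_le_neg_iff _ _).1.2 h.2, (game_neg_le_neg_iff _ _).1.2 h.1⟩⟩

end Value

theorem val_zero : val 0 = 0 := rfl

theorem val_add (x y : Game) : val (x + y) = val x + val y := rfl

theorem val_neg (x : Game) : val (-x) = -val x := rfl

namespace Value

theorem zero_add' (a : Value) : 0 + a = a := by
  obtain ⟨x, rfl⟩ := val_surjective a
  exact val_eq_val.2 (game_zero_add_le x)

theorem add_comm' (a b : Value) : a + b = b + a := by
  obtain ⟨x, rfl⟩ := val_surjective a
  obtain ⟨y, rfl⟩ := val_surjective b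
  exact val_eq_val.2 ⟨game_add_comm_le x y, game_add_comm_le y x⟩

instance : AddCommGroup Value where
  add_assoc a b c := by
    obtain ⟨x, rfl⟩ := val_surjective a
    obtain ⟨y, rfl⟩ := val_surjective b
    obtain ⟨z, rfl⟩ := val_surjective c
    exact val_eq_val.2 (game_add_assoc_le x y z)
  zero_add := zero_add'
  add_zero a := by rw [add_comm', zero_add']
  add_comm := add_comm'
  neg_add_cancel a := by
    obtain ⟨x, rfl⟩ := val_surjective a
    rw [add_comm']
    exact val_eq_val.2 (game_add_neg_le x)
  nsmul := nsmulRec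
  zsmul := zsmulRec

instance : IsOrderedAddMonoid Value where
  add_le_add_left a b h c := by
    obtain ⟨x, rfl⟩ := val_surjective a
    obtain ⟨y, rfl⟩ := val_surjective b
    obtain ⟨z, rfl⟩ := val_surjective c
    exact (add_le_add_right_game x y z).1.1 h

end Value

theorem val_le_val_iff {x y : Game} : val x ≤ val y ↔
    (∀ x', IsLeftOption x' x → ¬ val y ≤ val x') ∧
      ∀ y', IsRightOption y' y → ¬ val y' ≤ val x := le_iff

theorem IsLeftOption.not_val_le {x' x : Game} (h : IsLeftOption x' x) : ¬ val x ≤ val x' :=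
  h.not_le le_rfl

theorem IsRightOption.not_val_le {x' x : Game} (h : IsRightOption x' x) : ¬ val x' ≤ val x :=
  h.not_le le_rfl

theorem zero_le_val_iff {x : Game} : 0 ≤ val x ↔ ∀ x', IsRightOption x' x → ¬ val x' ≤ 0 :=
  val_le_val_iff.trans (and_iff_right fun _ h => (not_isLeftOption_zero _ h).elim)

theorem val_le_zero_iff {x : Game} : val x ≤ 0 ↔ ∀ x', IsLeftOption x' x → ¬ 0 ≤ val x' :=
  val_le_val_iff.trans (and_iff_left fun _ h => (not_isRightOption_zero _ h).elim)

theorem not_val_le_zero_iff {x : Game} :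
    ¬ val x ≤ 0 ↔ ∃ x', IsLeftOption x' x ∧ 0 ≤ val x' := by
  rw [val_le_zero_iff]; push Not; rfl

theorem not_zero_le_val_iff {x : Game} :
    ¬ 0 ≤ val x ↔ ∃ x', IsRightOption x' x ∧ val x' ≤ 0 := by
  rw [zero_le_val_iff]; push Not; rfl

theorem leftWins_iff (x : Game) :
    (LeftWinsFirst x ↔ ¬ val x ≤ 0) ∧ (LeftWinsSecond x ↔ 0 ≤ val x) := by
  induction x using option_induction with
  | h x xL xR =>
  rw [not_val_le_zero_iff, zero_le_val_iff]
  cases x with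
  | mk α β L R =>
    rw [LeftWinsFirst, LeftWinsSecond]
    constructor
    · constructor
      · rintro ⟨i, hi⟩
        exact ⟨_, ⟨i, rfl⟩, (xL _ ⟨i, rfl⟩).2.1 hi⟩
      · rintro ⟨_, ⟨i, rfl⟩, hi⟩
        exact ⟨i, (xL _ ⟨i, rfl⟩).2.2 hi⟩
    · constructor
      · rintro h _ ⟨j, rfl⟩
        exact (xR _ ⟨j, rfl⟩).1.1 (h j)
      · exact fun h j => (xR _ ⟨j, rfl⟩).1.2 (h _ ⟨j, rfl⟩)

theorem outcome_eq_iff {x y : Game} :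
    outcome x = outcome y ↔ (0 ≤ val x ↔ 0 ≤ val y) ∧ (val x ≤ 0 ↔ val y ≤ 0) := by
  rw [← (leftWins_iff x).2, ← (leftWins_iff y).2, ← not_iff_not (a := val x ≤ 0),
    ← (leftWins_iff x).1, ← (leftWins_iff y).1]
  simp only [outcome]
  split_ifs <;> simp_all

theorem val_congr {α β : Type} {L L' : α → Game} {R R' : β → Game}
    (hL : ∀ i, val (L i) = val (L' i)) (hR : ∀ j, val (R j) = val (R' j)) :
    val (mk α β L R) = val (mk α β L' R') := by
  have key : ∀ {L L' : α → Game} {R R' : β → Game}, (∀ i, val (L i) = val (L' i)) →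
      (∀ j, val (R j) = val (R' j)) → val (mk α β L R) ≤ val (mk α β L' R') := by
    intro L L' R R' hL hR
    refine val_le_val_iff.2 ⟨?_, ?_⟩
    · rintro _ ⟨i, rfl⟩
      rw [hL]
      exact IsLeftOption.not_val_le ⟨i, rfl⟩
    · rintro _ ⟨j, rfl⟩
      rw [← hR]
      exact IsRightOption.not_val_le ⟨j, rfl⟩
  exact le_antisymm (key hL hR) (key (fun i => (hL i).symm) fun j => (hR j).symm)

/-! ### Short games -/

theorem isShort_mk {α β : Type} {L : α → Game} {R : β → Game} : (mk α β L R).IsShort ↔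
    Finite α ∧ Finite β ∧ (∀ i, (L i).IsShort) ∧ ∀ j, (R j).IsShort := by
  rw [IsShort]

theorem IsShort.left {x x' : Game} (hx : x.IsShort) (h : IsLeftOption x' x) : x'.IsShort := by
  cases x with
  | mk α β L R =>
    obtain ⟨i, rfl⟩ := h
    exact (isShort_mk.1 hx).2.2.1 i

theorem IsShort.right {x x' : Game} (hx : x.IsShort) (h : IsRightOption x' x) : x'.IsShort := by
  cases x with
  | mk α β L R =>
    obtain ⟨i, rfl⟩ := h
    exact (isShort_mk.1 hx).2.2.2 i

theorem IsShort.finite_leftOptions {x : Game} (hx : x.IsShort) :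
    {x' | IsLeftOption x' x}.Finite := by
  cases x with
  | mk α β L R =>
    have := (isShort_mk.1 hx).1
    refine (Set.finite_range L).subset ?_
    rintro _ ⟨i, rfl⟩
    exact ⟨i, rfl⟩

theorem IsShort.finite_rightOptions {x : Game} (hx : x.IsShort) :
    {x' | IsRightOption x' x}.Finite := by
  cases x with
  | mk α β L R =>
    have := (isShort_mk.1 hx).2.1
    refine (Set.finite_range R).subset ?_
    rintro _ ⟨i, rfl⟩
    exact ⟨i, rfl⟩

theorem isShort_zero : (0 : Game).IsShort :=
  isShort_mk.2 ⟨inferInstance, inferInstance, fun i => i.elim, fun i => i.elim⟩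

theorem IsShort.neg {x : Game} (hx : x.IsShort) : (-x).IsShort := by
  induction x with
  | mk α β L R ihL ihR =>
    rw [isShort_mk] at hx
    rw [neg_mk, isShort_mk]
    exact ⟨hx.2.1, hx.1, fun j => ihR j (hx.2.2.2 j), fun i => ihL i (hx.2.2.1 i)⟩

theorem IsShort.add {x y : Game} (hx : x.IsShort) (hy : y.IsShort) : (x + y).IsShort := by
  induction x generalizing y with
  | mk α β L R ihL ihR =>
    induction y with
    | mk α' β' L' R' ihL' ihR' =>
      have hx' := isShort_mk.1 hx
      have hy' := isShort_mk.1 hy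
      obtain ⟨_, _, hL, hR⟩ := hx'
      obtain ⟨_, _, hL', hR'⟩ := hy'
      rw [mk_add_mk, isShort_mk]
      refine ⟨inferInstance, inferInstance, ?_, ?_⟩
      · rintro (i | i)
        · exact ihL i (hL i) hy
        · exact ihL' i (hL' i)
      · rintro (i | i)
        · exact ihR i (hR i) hy
        · exact ihR' i (hR' i)

/-! ### Nim-heaps and the far star -/

theorem isLeftOption_nim {z : Game} {n : ℕ} : IsLeftOption z (nim n) ↔ ∃ k < n, z = nim k := by
  rw [nim]
  exact ⟨fun ⟨i, h⟩ => ⟨i, i.2, h⟩, fun ⟨k, hk, h⟩ => ⟨⟨k, hk⟩, h⟩⟩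

theorem isRightOption_nim {z : Game} {n : ℕ} : IsRightOption z (nim n) ↔ ∃ k < n, z = nim k := by
  rw [nim]
  exact ⟨fun ⟨i, h⟩ => ⟨i, i.2, h⟩, fun ⟨k, hk, h⟩ => ⟨⟨k, hk⟩, h⟩⟩

theorem isLeftOption_farStar {z : Game} : IsLeftOption z farStar ↔ ∃ k, z = nim k := Iff.rfl

theorem isRightOption_farStar {z : Game} : IsRightOption z farStar ↔ ∃ k, z = nim k := Iff.rfl

theorem isShort_nim (n : ℕ) : (nim n).IsShort := by
  induction n using Nat.strong_induction_on with
  | _ n ih =>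
    rw [nim, isShort_mk]
    exact ⟨inferInstance, inferInstance, fun i => ih i i.2, fun i => ih i i.2⟩

theorem neg_nim (n : ℕ) : -nim n = nim n := by
  induction n using Nat.strong_induction_on with
  | _ n ih =>
    rw [nim, neg_mk]
    simp only [ih _ (Fin.is_lt _)]

theorem neg_farStar : -farStar = farStar := by
  rw [farStar, neg_mk]
  simp only [neg_nim]

theorem neg_val_nim (n : ℕ) : -val (nim n) = val (nim n) := by rw [← val_neg, neg_nim]

theorem neg_val_farStar : -val farStar = val farStar := by rw [← val_neg, neg_farStar]

theorem val_nim_add_self (n : ℕ) : val (nim n) + val (nim n) = 0 := by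
  nth_rewrite 1 [← neg_val_nim]
  exact neg_add_cancel _

theorem val_farStar_add_self : val farStar + val farStar = 0 := by
  nth_rewrite 1 [← neg_val_farStar]
  exact neg_add_cancel _

theorem not_farStar_le_nim (n : ℕ) : ¬ val farStar ≤ val (nim n) :=
  IsLeftOption.not_val_le (isLeftOption_farStar.2 ⟨n, rfl⟩)

theorem val_nim_zero : val (nim 0) = 0 := by
  refine le_antisymm (val_le_zero_iff.2 fun x' h => ?_) (zero_le_val_iff.2 fun x' h => ?_)
  · obtain ⟨k, hk, -⟩ := isLeftOption_nim.1 h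
    exact absurd hk (Nat.not_lt_zero k)
  · obtain ⟨k, hk, -⟩ := isRightOption_nim.1 h
    exact absurd hk (Nat.not_lt_zero k)

theorem val_star : val star = val (nim 1) := by
  have h : ∀ {z : Game}, (IsLeftOption z star ↔ z = 0) ∧ (IsRightOption z star ↔ z = 0) :=
    fun {z} => ⟨⟨fun ⟨_, h⟩ => h, fun h => ⟨(), h⟩⟩, ⟨fun ⟨_, h⟩ => h, fun h => ⟨(), h⟩⟩⟩
  have h0 : val (nim 0) = val 0 := val_nim_zero
  refine le_antisymm (val_le_val_iff.2 ⟨?_, ?_⟩) (val_le_val_iff.2 ⟨?_, ?_⟩)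
  · rintro z hz
    rw [h.1.1 hz, ← h0]
    exact IsLeftOption.not_val_le (isLeftOption_nim.2 ⟨0, one_pos, rfl⟩)
  · rintro z hz
    obtain ⟨k, hk, rfl⟩ := isRightOption_nim.1 hz
    rw [Nat.lt_one_iff.1 hk, h0]
    exact IsRightOption.not_val_le (h.2.2 rfl)
  · rintro z hz
    obtain ⟨k, hk, rfl⟩ := isLeftOption_nim.1 hz
    rw [Nat.lt_one_iff.1 hk, h0]
    exact IsLeftOption.not_val_le (h.1.2 rfl)
  · rintro z hz
    rw [h.2.1 hz, ← h0]
    exact IsRightOption.not_val_le (isRightOption_nim.2 ⟨0, one_pos, rfl⟩)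

/-- Bouton's strategy for three heaps: a move destroys the zero nim-sum, and some heap can then be
lowered to restore it. As heaps are their own negatives, this yields the addition rule
`val_nim_add_nim`. -/
theorem zero_le_nim_add_nim_add_nim {a b c : ℕ} (h : a ^^^ b ^^^ c = 0) :
    0 ≤ val (nim a + nim b + nim c) := by
  induction hn : a + b + c using Nat.strong_induction_on generalizing a b c with
  | _ n ih =>
  subst hn
  have key : ∀ a' b' c', a' + b' + c' < a + b + c → a' ^^^ b' ^^^ c' ≠ 0 →
      ¬ val (nim a' + nim b' + nim c') ≤ 0 := by
    intro a' b' c' hlt hne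
    rw [not_val_le_zero_iff]
    rcases Nat.xor_trichotomy hne with h | h | h
    · refine ⟨_, ((isLeftOption_nim.2 ⟨_, h, rfl⟩).add_right _).add_right _,
        ih _ (by omega) ?_ rfl⟩
      rw [Nat.xor_assoc, Nat.xor_self]
    · refine ⟨_, ((isLeftOption_nim.2 ⟨_, h, rfl⟩).add_left _).add_right _,
        ih _ (by omega) ?_ rfl⟩
      rw [Nat.xor_comm c', ← Nat.xor_assoc, Nat.xor_self, Nat.zero_xor, Nat.xor_self]
    · refine ⟨_, (isLeftOption_nim.2 ⟨_, h, rfl⟩).add_left _, ih _ (by omega) ?_ rfl⟩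
      rw [Nat.xor_self]
  rw [zero_le_val_iff]
  intro x' hx'
  rcases isRightOption_add.1 hx' with ⟨y, hy, rfl⟩ | ⟨y, hy, rfl⟩
  · rcases isRightOption_add.1 hy with ⟨z, hz, rfl⟩ | ⟨z, hz, rfl⟩
    · obtain ⟨k, hk, rfl⟩ := isRightOption_nim.1 hz
      refine key _ _ _ (by omega) fun hc => hk.ne ?_
      rw [← h, Nat.xor_assoc, Nat.xor_assoc] at hc
      exact Nat.xor_left_injective hc
    · obtain ⟨k, hk, rfl⟩ := isRightOption_nim.1 hz
      refine key _ _ _ (by omega) fun hc => hk.ne ?_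
      rw [← h, Nat.xor_assoc, Nat.xor_assoc] at hc
      exact Nat.xor_left_injective (Nat.xor_right_injective hc)
  · obtain ⟨k, hk, rfl⟩ := isRightOption_nim.1 hy
    refine key _ _ _ (by omega) fun hc => hk.ne ?_
    rw [← h] at hc
    exact Nat.xor_right_injective hc

theorem val_nim_add_nim (a b : ℕ) : val (nim a) + val (nim b) = val (nim (a ^^^ b)) := by
  have h : 0 ≤ val (nim a) + val (nim b) + val (nim (a ^^^ b)) :=
    zero_le_nim_add_nim_add_nim (Nat.xor_self _)
  refine le_antisymm ?_ ?_
  · rw [← neg_le_neg_iff, neg_add, neg_val_nim, neg_val_nim, neg_val_nim, ← sub_nonneg,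
      sub_eq_add_neg, neg_val_nim]
    exact h
  · rw [← sub_nonneg, sub_eq_add_neg, neg_val_nim]
    exact h

/-! ### The far star absorbs nim-heaps -/

/-- Since ☆ and `*n` are their own negatives, failure would give ☆ ≤ v ≤ `*n`, although `*n` is a
Left option of ☆. -/
theorem not_add_nim_le_zero {v : Value} (h : 0 ≤ v + val farStar) (n : ℕ) :
    ¬ v + val (nim n) ≤ 0 := by
  intro hc
  rw [← neg_val_farStar, ← sub_eq_add_neg, sub_nonneg] at h
  rw [← neg_val_nim, ← sub_eq_add_neg, sub_nonpos] at hc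
  exact not_farStar_le_nim n (h.trans hc)

-- A short game has finitely many followers, so Left's winning play against ☆ uses only finitely
-- many heaps; a heap larger than all of these does the work of ☆.
open Filter in
theorem eventually_of_add_farStar {x : Game} (hx : x.IsShort) : ∀ᶠ n in atTop,
    (0 ≤ val x + val farStar → 0 ≤ val x + val (nim n)) ∧
      (¬ val x + val farStar ≤ 0 → ¬ val x + val (nim n) ≤ 0) := by
  induction x using option_induction with
  | h x xL xR =>
  have hL := (eventually_all_finite hx.finite_leftOptions).2 fun x' h => xL x' h (hx.left h)
  have hR := (eventually_all_finite hx.finite_rightOptions).2 fun x' h => xR x' h (hx.right h)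
  have hk : ∀ᶠ n in atTop, (∃ k, 0 ≤ val x + val (nim k)) → ∃ k < n, 0 ≤ val x + val (nim k) := by
    by_cases h : ∃ k, 0 ≤ val x + val (nim k)
    · obtain ⟨k, hk⟩ := h
      exact (eventually_gt_atTop k).mono fun n hn _ => ⟨k, hn, hk⟩
    · exact Eventually.of_forall fun n hc => (h hc).elim
  filter_upwards [hL, hR, hk] with n hL hR hk
  constructor
  · intro h
    refine zero_le_val_iff (x := x + nim n).2 fun z hz => ?_
    rcases isRightOption_add.1 hz with ⟨x', hx', rfl⟩ | ⟨y', hy', rfl⟩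
    · exact (hR x' hx').2 (zero_le_val_iff (x := x + farStar).1 h _ (hx'.add_right _))
    · obtain ⟨k, -, rfl⟩ := isRightOption_nim.1 hy'
      exact not_add_nim_le_zero h k
  · intro h
    obtain ⟨z, hz, hz0⟩ := not_val_le_zero_iff (x := x + farStar).1 h
    rcases isLeftOption_add.1 hz with ⟨x', hx', rfl⟩ | ⟨y', hy', rfl⟩
    · exact not_val_le_zero_iff (x := x + nim n).2
        ⟨_, hx'.add_right _, (hL x' hx').1 hz0⟩
    · obtain ⟨k, rfl⟩ := isLeftOption_farStar.1 hy'
      obtain ⟨k, hkn, hk⟩ := hk ⟨k, hz0⟩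
      exact not_val_le_zero_iff (x := x + nim n).2
        ⟨_, (isLeftOption_nim.2 ⟨k, hkn, rfl⟩).add_left _, hk⟩

/-- A move of ☆ to `*k` in the game without `*j` corresponds to a move of ☆ to `*(k ^^^ j)` in the
game with it. Only a move in `*j` itself needs another argument. -/
theorem farStar_add_nim {x : Game} (hx : x.IsShort) (j : ℕ) :
    (0 ≤ val x + val farStar → 0 ≤ val x + val farStar + val (nim j)) ∧
      (¬ val x + val farStar ≤ 0 → ¬ val x + val farStar + val (nim j) ≤ 0) := by
  induction x using option_induction with
  | h x xL xR =>
  constructor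
  · intro h
    refine zero_le_val_iff (x := x + farStar + nim j).2 fun z hz => ?_
    rcases isRightOption_add.1 hz with ⟨y, hy, rfl⟩ | ⟨y, hy, rfl⟩
    · rcases isRightOption_add.1 hy with ⟨x', hx', rfl⟩ | ⟨y', hy', rfl⟩
      · exact (xR x' hx' (hx.right hx')).2
          (zero_le_val_iff (x := x + farStar).1 h _ (hx'.add_right _))
      · obtain ⟨k, rfl⟩ := isRightOption_farStar.1 hy'
        simp only [val_add, add_assoc, val_nim_add_nim]
        exact not_add_nim_le_zero h _
    · obtain ⟨k, -, rfl⟩ := isRightOption_nim.1 hy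
      -- Some heap satisfies `*n` ≤ x, so a loss for Left here would put ☆ below `*(n ^^^ k)`.
      obtain ⟨n, hn⟩ := (eventually_of_add_farStar hx).exists
      intro hc
      refine not_farStar_le_nim (n ^^^ k) ?_
      rw [← val_nim_add_nim, ← sub_nonpos]
      refine le_trans ?_ hc
      have h1 := hn.1 h
      rw [← neg_val_nim, ← sub_eq_add_neg, sub_nonneg] at h1
      calc val farStar - (val (nim n) + val (nim k))
          = val farStar + (-val (nim n) + -val (nim k)) := by abel
        _ = val (nim n) + val farStar + val (nim k) := by
          rw [neg_val_nim, neg_val_nim]; abel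
        _ ≤ val x + val farStar + val (nim k) := by gcongr
  · intro h
    obtain ⟨z, hz, hz0⟩ := not_val_le_zero_iff (x := x + farStar).1 h
    refine not_val_le_zero_iff (x := x + farStar + nim j).2 ?_
    rcases isLeftOption_add.1 hz with ⟨x', hx', rfl⟩ | ⟨y', hy', rfl⟩
    · exact ⟨_, (hx'.add_right _).add_right _, (xL x' hx' (hx.left hx')).1 hz0⟩
    · obtain ⟨k, rfl⟩ := isLeftOption_farStar.1 hy'
      refine ⟨_, ((isLeftOption_farStar.2 ⟨k ^^^ j, rfl⟩).add_left _).add_right _, ?_⟩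
      rw [val_add, val_add, add_assoc, val_nim_add_nim, Nat.xor_assoc, Nat.xor_self, Nat.xor_zero]
      exact hz0

theorem zero_le_add_farStar_add_nim_iff {x : Game} (hx : x.IsShort) (j : ℕ) :
    0 ≤ val x + val farStar + val (nim j) ↔ 0 ≤ val x + val farStar := by
  refine ⟨fun h => ?_, (farStar_add_nim hx j).1⟩
  -- The converse comes from adding `*j` a second time, since `*j + *j = 0`.
  have := (farStar_add_nim (hx.add (isShort_nim j)) j).1
  rw [val_add] at this
  have h2 := this (by rwa [add_right_comm])
  rwa [add_right_comm, add_assoc (val x), val_nim_add_self, add_zero] at h2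

theorem add_farStar_add_nim_le_zero_iff {x : Game} (hx : x.IsShort) (j : ℕ) :
    val x + val farStar + val (nim j) ≤ 0 ↔ val x + val farStar ≤ 0 := by
  have h := zero_le_add_farStar_add_nim_iff hx.neg j
  rw [val_neg] at h
  rwa [← neg_val_farStar, ← neg_val_nim, ← neg_add, ← neg_add, neg_nonneg, neg_nonneg] at h

/-! ### Equivalence modulo the far star -/

theorem not_star_le_up : ¬ val star ≤ val up := IsRightOption.not_val_le ⟨(), rfl⟩

theorem neg_zero_game : -(0 : Game) = 0 := by
  change mk Empty Empty _ _ = mk Empty Empty _ _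
  congr 1 <;> exact funext fun i => i.elim

theorem neg_star : -star = star := by rw [star, neg_mk, neg_zero_game]

theorem neg_up : -up = down := by rw [up, neg_mk, neg_zero_game, neg_star, down]

theorem val_down : val down = -val up := by rw [← val_neg, neg_up]

theorem isShort_star : star.IsShort :=
  isShort_mk.2 ⟨inferInstance, inferInstance, fun _ => isShort_zero, fun _ => isShort_zero⟩

theorem isShort_up : up.IsShort :=
  isShort_mk.2 ⟨inferInstance, inferInstance, fun _ => isShort_zero, fun _ => isShort_star⟩

theorem isShort_down : down.IsShort := neg_up ▸ isShort_up.neg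

/-- If `g` exceeds `↓☆`, then adding `g` does not harm Left in sums that contain `☆`. -/
theorem add_farStar_of_zero_le {g x : Game} (hg : g.IsShort) (hx : x.IsShort) :
    (0 ≤ val g + val up + val farStar → 0 ≤ val x + val farStar →
      0 ≤ val g + val x + val farStar) ∧
    (0 ≤ val g + val up + val farStar → ¬ val x + val farStar ≤ 0 →
      ¬ val g + val x + val farStar ≤ 0) ∧
    (¬ val g + val up + val farStar ≤ 0 → 0 ≤ val x + val farStar →
      ¬ val g + val x + val farStar ≤ 0) := by
  -- That * is not below ↑ is the source of the contradiction when ☆ has been moved to a heap: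
  -- absorption lets ☆ supply the extra *.
  have not_le_up : ∀ {v : Value}, 0 ≤ v + val star → ¬ v ≤ val up := by
    intro v h hc
    rw [val_star, ← neg_val_nim, ← val_star, ← sub_eq_add_neg, sub_nonneg] at h
    exact not_star_le_up (h.trans hc)
  induction g using option_induction generalizing x with
  | h g gL gR =>
  induction x using option_induction with
  | h x xL xR =>
  refine ⟨fun h1 h2 => ?_, fun h1 h2 hc => ?_, fun h1 h2 hc => ?_⟩
  · refine zero_le_val_iff (x := g + x + farStar).2 fun z hz => ?_
    rcases isRightOption_add.1 hz with ⟨y, hy, rfl⟩ | ⟨y, hy, rfl⟩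
    · rcases isRightOption_add.1 hy with ⟨g', hg', rfl⟩ | ⟨x', hx', rfl⟩
      · exact (gR g' hg' (hg.right hg') hx).2.2 (zero_le_val_iff (x := g + up + farStar).1 h1 _
          ((hg'.add_right _).add_right _)) h2
      · exact (xR x' hx' (hx.right hx')).2.1 h1 (zero_le_val_iff (x := x + farStar).1 h2 _
          (hx'.add_right _))
    · obtain ⟨k, rfl⟩ := isRightOption_farStar.1 hy
      intro hc
      -- The heap `k ^^^ 1` is chosen so that absorption produces both the `*k` Right has left and
      -- the extra *.
      have h3 := (zero_le_add_farStar_add_nim_iff hx (k ^^^ 1)).2 h2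
      rw [← val_nim_add_nim, ← val_star, ← add_assoc] at h3
      refine not_le_up h3 (sub_nonneg.1 ?_)
      have e : val up - (val x + val farStar + val (nim k)) = (val g + val up + val farStar) -
        (val g + val x + val (nim k)) - (val farStar + val farStar) := by abel
      rw [e, val_farStar_add_self, sub_zero]
      exact sub_nonneg.2 (hc.trans h1)
  · obtain ⟨z, hz, hz0⟩ := not_val_le_zero_iff (x := x + farStar).1 h2
    rcases isLeftOption_add.1 hz with ⟨x', hx', rfl⟩ | ⟨y', hy', rfl⟩
    · exact val_le_zero_iff (x := g + x + farStar).1 hc _ ((hx'.add_left _).add_right _)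
        ((xL x' hx' (hx.left hx')).1 h1 hz0)
    · obtain ⟨k, rfl⟩ := isLeftOption_farStar.1 hy'
      rw [val_add] at hz0
      have h3 : val g + val farStar + val (nim k) ≤ 0 := by
        have e : val g + val farStar + val (nim k) = (val g + val x + val farStar) -
          (val x + val (nim k)) + (val (nim k) + val (nim k)) := by abel
        rw [e, val_nim_add_self, add_zero]
        exact sub_nonpos.2 (hc.trans hz0)
      rw [add_farStar_add_nim_le_zero_iff hg, ← add_farStar_add_nim_le_zero_iff hg 1,
        ← val_star] at h3
      refine not_star_le_up (sub_nonneg.1 ?_)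
      have e : val up - val star = (val g + val up + val farStar) -
        (val g + val farStar + val star) := by abel
      rw [e]
      exact sub_nonneg.2 (h3.trans h1)
  · obtain ⟨z, hz, hz0⟩ := not_val_le_zero_iff (x := g + up + farStar).1 h1
    rcases isLeftOption_add.1 hz with ⟨y, hy, rfl⟩ | ⟨y, hy, rfl⟩
    · rcases isLeftOption_add.1 hy with ⟨g', hg', rfl⟩ | ⟨y', ⟨_, rfl⟩, rfl⟩
      · exact val_le_zero_iff (x := g + x + farStar).1 hc _ ((hg'.add_right _).add_right _)
          ((gL g' hg' (hg.left hg') hx).1 hz0 h2)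
      · rw [val_add, val_add, val_zero, add_zero] at hz0
        refine not_farStar_le_nim 0 (sub_nonneg.1 ?_)
        have e : val (nim 0) - val farStar = (val x + val farStar) + (val g + val farStar) -
          (val g + val x + val farStar) - (val farStar + val farStar) := by
          rw [val_nim_zero]; abel
        rw [e, val_farStar_add_self, sub_zero]
        exact sub_nonneg.2 (hc.trans (add_nonneg h2 hz0))
    · obtain ⟨k, rfl⟩ := isLeftOption_farStar.1 hy
      rw [val_add, val_add] at hz0
      have h3 := (zero_le_add_farStar_add_nim_iff hx (k ^^^ 1)).2 h2
      rw [← val_nim_add_nim, ← val_star, ← add_assoc] at h3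
      refine not_le_up h3 (sub_nonneg.1 ?_)
      have e : val up - (val x + val farStar + val (nim k)) = (val g + val up + val (nim k)) -
        (val g + val x + val farStar) - (val (nim k) + val (nim k)) := by abel
      rw [e, val_nim_add_self, sub_zero]
      exact sub_nonneg.2 (hc.trans hz0)

/-- If the difference of `g` and `h` lies between `↓☆` and `↑☆`, then `g` and `h` are equivalent
modulo the far star. -/
theorem farStarEquiv_of_zero_le {g h : Game} (hg : g.IsShort) (hh : h.IsShort)
    (h1 : 0 ≤ val g - val h + val up + val farStar)
    (h2 : 0 ≤ val h - val g + val up + val farStar) : FarStarEquiv g h := by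
  intro x hx
  have key : ∀ {g h : Game}, g.IsShort → h.IsShort →
      0 ≤ val g - val h + val up + val farStar →
      (0 ≤ val (h + x + farStar) → 0 ≤ val (g + x + farStar)) ∧
      (val (g + x + farStar) ≤ 0 → val (h + x + farStar) ≤ 0) := by
    intro g h hg hh h1
    rw [sub_eq_add_neg, ← val_neg, ← val_add] at h1
    have := add_farStar_of_zero_le (hg.add hh.neg) (hh.add hx)
    have e : val (g + -h) + val (h + x) = val (g + x) := by
      rw [val_add, val_add, val_add, val_neg]; abel
    rw [e] at this
    exact ⟨this.1 h1, fun hc => by_contra fun hn => this.2.1 h1 hn hc⟩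
  rw [outcome_eq_iff]
  exact ⟨⟨(key hh hg h2).1, (key hg hh h1).1⟩, ⟨(key hg hh h1).2, (key hh hg h2).2⟩⟩

end Game

open Stone

/-! ### Rows of stones -/

/-- The excess of white stones in a row. -/
def rowExcess (l : List Stone) : ℤ := (l.count white : ℤ) - (l.count black : ℤ)

theorem rowExcess_append (a b : List Stone) :
    rowExcess (a ++ b) = rowExcess a + rowExcess b := by
  simp only [rowExcess, List.count_append]; push_cast; ring

theorem rowExcess_cons_black (a : List Stone) :
    rowExcess (black :: a) = rowExcess a - 1 := by
  simp [rowExcess]; ring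

theorem rowExcess_cons_white (a : List Stone) :
    rowExcess (white :: a) = rowExcess a + 1 := by
  simp [rowExcess]; ring

/-- Remove the white stones at the left end. -/
abbrev dropWhite (l : List Stone) : List Stone := l.dropWhile (fun x => decide (x = white))

/-- Remove the black stones at the right end. -/
abbrev rdropBlack (l : List Stone) : List Stone := l.rdropWhile (fun x => decide (x = black))

theorem removeDead_eq (l : List Stone) : removeDead l = rdropBlack (dropWhite l) := rfl

theorem dropWhite_cons_white (l : List Stone) : dropWhite (white :: l) = dropWhite l :=
  List.dropWhile_cons_of_pos (by simp)

theorem dropWhite_cons_black (l : List Stone) : dropWhite (black :: l) = black :: l :=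
  List.dropWhile_cons_of_neg (by simp)

theorem rdropBlack_concat_black (l : List Stone) : rdropBlack (l ++ [black]) = rdropBlack l :=
  List.rdropWhile_concat_pos _ _ _ (by simp)

theorem rdropBlack_concat_white (l : List Stone) :
    rdropBlack (l ++ [white]) = l ++ [white] :=
  List.rdropWhile_concat_neg _ _ _ (by simp)

theorem rowExcess_le_rdropBlack (l : List Stone) : rowExcess l ≤ rowExcess (rdropBlack l) := by
  induction l using List.reverseRecOn with
  | nil => simp
  | append_singleton l c ih =>
    cases c
    · rw [rdropBlack_concat_black, rowExcess_append, rowExcess_cons_black]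
      simp only [rowExcess, List.count_nil] at ih ⊢
      omega
    · rw [rdropBlack_concat_white]

theorem rowExcess_dropWhite_le_removeDead (l : List Stone) :
    rowExcess (dropWhite l) ≤ rowExcess (removeDead l) := rowExcess_le_rdropBlack _

theorem AllAlive.head_eq {c : Stone} {l : List Stone} (h : AllAlive (c :: l)) : c = black := by
  cases c with
  | black => rfl
  | white => exact absurd (h.2 [] l rfl) (by simp)

theorem AllAlive.last_eq {c : Stone} {l : List Stone} (h : AllAlive (l ++ [c])) : c = white := by
  cases c with
  | white => rfl
  | black => exact absurd (h.1 l [] rfl) (by simp)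

theorem AllAlive.removeDead_eq {l : List Stone} (h : AllAlive l) : removeDead l = l := by
  have h1 : dropWhite l = l := by
    cases l with
    | nil => rfl
    | cons c l => rw [h.head_eq, dropWhite_cons_black]
  rw [CGT.removeDead_eq, h1]
  rcases List.eq_nil_or_concat' l with rfl | ⟨l', c, rfl⟩
  · rfl
  · rw [h.last_eq, rdropBlack_concat_white]

/-! ### Mirror images -/

/-- The other colour. -/
def Stone.flip : Stone → Stone
  | black => white
  | white => black

theorem Stone.flip_flip (c : Stone) : c.flip.flip = c := by cases c <;> rfl

/-- The row with both its orientation and its colours interchanged. -/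
def mirrorRow (l : List Stone) : List Stone := (l.map Stone.flip).reverse

theorem mirrorRow_mirrorRow (l : List Stone) : mirrorRow (mirrorRow l) = l := by
  simp [mirrorRow, List.map_reverse, Function.comp_def, Stone.flip_flip]

theorem mirrorRow_append (a b : List Stone) :
    mirrorRow (a ++ b) = mirrorRow b ++ mirrorRow a := by simp [mirrorRow]

theorem mirrorRow_cons (c : Stone) (b : List Stone) :
    mirrorRow (c :: b) = mirrorRow b ++ [c.flip] := by simp [mirrorRow]

theorem flip_mem_mirrorRow {c : Stone} {l : List Stone} : c.flip ∈ mirrorRow l ↔ c ∈ l := by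
  have : Function.Injective Stone.flip :=
    Function.LeftInverse.injective (g := Stone.flip) Stone.flip_flip
  simp [mirrorRow, this.eq_iff]

theorem rowExcess_mirrorRow (l : List Stone) : rowExcess (mirrorRow l) = -rowExcess l := by
  induction l with
  | nil => rfl
  | cons c l ih =>
    rw [mirrorRow_cons, rowExcess_append, ih]
    cases c
    · rw [rowExcess_cons_black, Stone.flip, rowExcess_cons_white]; simp [rowExcess]; ring
    · rw [rowExcess_cons_white, Stone.flip, rowExcess_cons_black]; simp [rowExcess]; ring

theorem mirrorRow_dropWhite (l : List Stone) :
    mirrorRow (dropWhite l) = rdropBlack (mirrorRow l) := by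
  induction l with
  | nil => rfl
  | cons c l ih =>
    cases c
    · rw [dropWhite_cons_black, mirrorRow_cons, Stone.flip, rdropBlack_concat_white]
    · rw [dropWhite_cons_white, mirrorRow_cons, Stone.flip, rdropBlack_concat_black, ih]

theorem mirrorRow_rdropBlack (l : List Stone) :
    mirrorRow (rdropBlack l) = dropWhite (mirrorRow l) := by
  rw [← mirrorRow_mirrorRow (dropWhite _), mirrorRow_dropWhite, mirrorRow_mirrorRow]

theorem rdropBlack_cons_white (l : List Stone) :
    rdropBlack (white :: l) = white :: rdropBlack l := by
  induction l using List.reverseRecOn with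
  | nil => rfl
  | append_singleton l c ih =>
    rw [← List.cons_append]
    cases c
    · rw [rdropBlack_concat_black, rdropBlack_concat_black, ih]
    · rw [rdropBlack_concat_white, rdropBlack_concat_white]; rfl

/-- Mirroring exchanges the two ends, so compatibility of `removeDead` with mirror images requires
that the order of the two removals be irrelevant. -/
theorem dropWhite_rdropBlack_comm (l : List Stone) :
    dropWhite (rdropBlack l) = rdropBlack (dropWhite l) := by
  induction l with
  | nil => rfl
  | cons c l ih =>
    cases c
    · rw [dropWhite_cons_black]
      obtain ⟨t, ht⟩ := List.rdropWhile_prefix (fun x => decide (x = black)) (l := black :: l)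
      change rdropBlack (black :: l) ++ t = _ at ht
      rcases h : rdropBlack (black :: l) with - | ⟨c, l'⟩
      · rfl
      · rw [h] at ht
        rw [(List.cons.inj ht).1, dropWhite_cons_black]
    · rw [rdropBlack_cons_white, dropWhite_cons_white, dropWhite_cons_white, ih]

theorem removeDead_mirrorRow (l : List Stone) :
    removeDead (mirrorRow l) = mirrorRow (removeDead l) := by
  rw [removeDead_eq, removeDead_eq, mirrorRow_rdropBlack, mirrorRow_dropWhite,
    dropWhite_rdropBlack_comm]

namespace Strip

theorem ext_stones {s t : Strip} (h : s.stones = t.stones) : s = t := by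
  cases s; cases t; cases h; rfl

theorem ofRow_stones (s : Strip) : ofRow s.stones = s := ext_stones s.alive.removeDead_eq

theorem excess_eq (s : Strip) : s.excess = rowExcess s.stones := rfl

/-- The mirror image of a strip, in which the roles of the players are interchanged. -/
def mirror (s : Strip) : Strip := ofRow (mirrorRow s.stones)

theorem mirror_stones (s : Strip) : s.mirror.stones = mirrorRow s.stones := by
  change removeDead _ = _
  rw [removeDead_mirrorRow, s.alive.removeDead_eq]

theorem mirror_mirror (s : Strip) : s.mirror.mirror = s :=
  ext_stones (by rw [mirror_stones, mirror_stones, mirrorRow_mirrorRow])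

theorem mirror_ofRow (l : List Stone) : (ofRow l).mirror = ofRow (mirrorRow l) :=
  ext_stones (by rw [mirror_stones]; exact (removeDead_mirrorRow l).symm)

theorem mirror_excess (s : Strip) : s.mirror.excess = -s.excess := by
  rw [excess_eq, mirror_stones, rowExcess_mirrorRow, excess_eq]

theorem LeftMove.mirror {s t : Strip} (h : LeftMove s t) : RightMove s.mirror t.mirror := by
  obtain ⟨a, m, b, hs, hm, rfl⟩ := h
  refine ⟨mirrorRow b, mirrorRow m, mirrorRow a, ?_, ?_, ?_⟩
  · rw [mirror_stones, hs]
    simp [mirrorRow_append, mirrorRow_cons, Stone.flip]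
  · rwa [← flip_mem_mirrorRow] at hm
  · rw [mirror_ofRow]
    simp [mirrorRow_append, mirrorRow_cons, Stone.flip]

theorem RightMove.mirror {s t : Strip} (h : RightMove s t) : LeftMove s.mirror t.mirror := by
  obtain ⟨a, m, b, hs, hm, rfl⟩ := h
  refine ⟨mirrorRow b, mirrorRow m, mirrorRow a, ?_, ?_, ?_⟩
  · rw [mirror_stones, hs]
    simp [mirrorRow_append, mirrorRow_cons, Stone.flip]
  · rwa [← flip_mem_mirrorRow] at hm
  · rw [mirror_ofRow]
    simp [mirrorRow_append, mirrorRow_cons, Stone.flip]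

/-! ### The game on a strip -/

open Game

theorem isLeftOption_toGame {s : Strip} {z : Game} :
    IsLeftOption z s.toGame ↔ ∃ t, LeftMove s t ∧ z = t.toGame := by
  rw [toGame]
  exact ⟨fun ⟨t, h⟩ => ⟨t, t.2, h⟩, fun ⟨t, ht, h⟩ => ⟨⟨t, ht⟩, h⟩⟩

theorem isRightOption_toGame {s : Strip} {z : Game} :
    IsRightOption z s.toGame ↔ ∃ t, RightMove s t ∧ z = t.toGame := by
  rw [toGame]
  exact ⟨fun ⟨t, h⟩ => ⟨t, t.2, h⟩, fun ⟨t, ht, h⟩ => ⟨⟨t, ht⟩, h⟩⟩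

theorem val_mirror (s : Strip) : val s.mirror.toGame = -val s.toGame := by
  induction hn : inv s.stones using Nat.strong_induction_on generalizing s with
  | _ n ih =>
  subst hn
  rw [← val_neg]
  refine le_antisymm (val_le_val_iff.2 ⟨?_, ?_⟩) (val_le_val_iff.2 ⟨?_, ?_⟩)
  · rintro _ hz
    obtain ⟨t, ht, rfl⟩ := isLeftOption_toGame.1 hz
    have ht' := ht.mirror
    rw [mirror_mirror] at ht'
    have h := ih _ ht'.inv_lt _ rfl
    rw [mirror_mirror, ← val_neg] at h
    rw [h]
    refine IsLeftOption.not_val_le (isLeftOption_neg.2 ?_)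
    rw [game_neg_neg]
    exact isRightOption_toGame.2 ⟨_, ht', rfl⟩
  · rintro z hz
    rw [isRightOption_neg] at hz
    obtain ⟨t, ht, hz⟩ := isLeftOption_toGame.1 hz
    rw [← game_neg_neg z, hz, val_neg, ← ih _ ht.inv_lt _ rfl]
    exact IsRightOption.not_val_le (isRightOption_toGame.2 ⟨_, ht.mirror, rfl⟩)
  · rintro z hz
    rw [isLeftOption_neg] at hz
    obtain ⟨t, ht, hz⟩ := isRightOption_toGame.1 hz
    rw [← game_neg_neg z, hz, val_neg, ← ih _ ht.inv_lt _ rfl]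
    exact IsLeftOption.not_val_le (isLeftOption_toGame.2 ⟨_, ht.mirror, rfl⟩)
  · rintro _ hz
    obtain ⟨t, ht, rfl⟩ := isRightOption_toGame.1 hz
    have ht' := ht.mirror
    rw [mirror_mirror] at ht'
    have h := ih _ ht'.inv_lt _ rfl
    rw [mirror_mirror, ← val_neg] at h
    rw [h]
    refine IsRightOption.not_val_le (isRightOption_neg.2 ?_)
    rw [game_neg_neg]
    exact isLeftOption_toGame.2 ⟨_, ht', rfl⟩

instance : Finite Stone :=
  Finite.of_surjective (fun b : Bool => if b then black else white)
    (by rintro (_ | _); exacts [⟨true, rfl⟩, ⟨false, rfl⟩])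

/-- Before dead stones are removed, a move preserves the length of the row. -/
theorem finite_moves (s : Strip) : {t | LeftMove s t ∨ RightMove s t}.Finite := by
  refine ((List.finite_length_eq Stone s.stones.length).image ofRow).subset ?_
  rintro _ (⟨a, m, b, hs, -, rfl⟩ | ⟨a, m, b, hs, -, rfl⟩)
  all_goals exact ⟨_, by simp [hs], rfl⟩

theorem isShort_toGame (s : Strip) : s.toGame.IsShort := by
  induction hn : inv s.stones using Nat.strong_induction_on generalizing s with
  | _ n ih =>
  subst hn
  rw [toGame, isShort_mk]
  exact ⟨(s.finite_moves.subset fun t ht => Or.inl ht).to_subtype,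
    (s.finite_moves.subset fun t ht => Or.inr ht).to_subtype,
    fun t => ih _ t.2.inv_lt _ rfl, fun t => ih _ t.2.inv_lt _ rfl⟩

/-- Neighbouring stones may be interchanged by either player, so one player's having a move gives
the other one too. -/
theorem exists_adjacent (a m b : List Stone) :
    ∃ a' b', a ++ black :: (m ++ white :: b) = a' ++ black :: ([] ++ white :: b') := by
  induction m generalizing a with
  | nil => exact ⟨a, b, rfl⟩
  | cons c m ih =>
    cases c
    · obtain ⟨a', b', h⟩ := ih (a ++ [black])
      exact ⟨a', b', by rw [← h]; simp⟩
    · exact ⟨a, m ++ white :: b, rfl⟩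

theorem exists_leftMove_iff (s : Strip) : (∃ t, LeftMove s t) ↔ ∃ t, RightMove s t := by
  constructor
  · rintro ⟨_, a, m, b, hs, -, -⟩
    obtain ⟨a', b', h⟩ := exists_adjacent a m b
    exact ⟨_, a', [], b', hs.trans h, by simp, rfl⟩
  · rintro ⟨_, a, m, b, hs, -, -⟩
    obtain ⟨a', b', h⟩ := exists_adjacent a m b
    exact ⟨_, a', [], b', hs.trans h, by simp, rfl⟩

theorem isAllSmall_toGame (s : Strip) : s.toGame.IsAllSmall := by
  induction hn : inv s.stones using Nat.strong_induction_on generalizing s with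
  | _ n ih =>
  subst hn
  rw [toGame, IsAllSmall, nonempty_subtype, nonempty_subtype]
  exact ⟨s.exists_leftMove_iff, fun t => ih _ t.2.inv_lt _ rfl, fun t => ih _ t.2.inv_lt _ rfl⟩

end Strip

theorem Game.IsAllSmall.add {x y : Game} (hx : x.IsAllSmall) (hy : y.IsAllSmall) :
    (x + y).IsAllSmall := by
  induction x generalizing y with
  | mk α β L R ihL ihR =>
    induction y with
    | mk α' β' L' R' ihL' ihR' =>
      have hx' := hx
      have hy' := hy
      rw [Game.IsAllSmall] at hx' hy'
      obtain ⟨h, hL, hR⟩ := hx'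
      obtain ⟨h', hL', hR'⟩ := hy'
      rw [Game.mk_add_mk, Game.IsAllSmall, nonempty_sum, nonempty_sum, h, h']
      refine ⟨Iff.rfl, ?_, ?_⟩
      · rintro (i | i)
        · exact ihL i (hL i) hy
        · exact ihL' i (hL' i)
      · rintro (i | i)
        · exact ihR i (hR i) hy
        · exact ihR' i (hR' i)

theorem Game.isAllSmall_zero : (0 : Game).IsAllSmall :=
  ⟨Iff.rfl, fun i => i.elim, fun i => i.elim⟩

namespace Strip

open Game

/-- White stones die only if the leftmost black one is moved, and then only the single white stone
put in its place, because Right jumps over no white stone. Black stones that die can only raise the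
excess. -/
theorem RightMove.excess_le {s t : Strip} (h : RightMove s t) : s.excess - 1 ≤ t.excess := by
  obtain ⟨a, m, b, hs, hm, rfl⟩ := h
  refine le_trans ?_ (rowExcess_dropWhite_le_removeDead _)
  have halive := s.alive
  rw [excess_eq]
  rw [hs] at halive ⊢
  cases a with
  | nil =>
    have h : dropWhite ([] ++ white :: (m ++ black :: b)) = m ++ black :: b := by
      rw [List.nil_append, dropWhite_cons_white]
      cases m with
      | nil => exact dropWhite_cons_black _
      | cons c m =>
        cases c
        · exact dropWhite_cons_black _
        · simp at hm
    rw [h]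
    simp only [List.nil_append, rowExcess_append, rowExcess_cons_black, rowExcess_cons_white]
    omega
  | cons c a =>
    rw [AllAlive.head_eq halive, List.cons_append, List.cons_append, dropWhite_cons_black]
    simp only [rowExcess_append, rowExcess_cons_black, rowExcess_cons_white]
    omega

/-- The strip with a single black stone and `k` white ones (the empty strip if `k = 0`). -/
def bw (k : ℕ) : Strip := ofRow (black :: List.replicate k white)

theorem bw_zero_stones : (bw 0).stones = [] := rfl

theorem bw_succ_stones (k : ℕ) :
    (bw (k + 1)).stones = black :: List.replicate (k + 1) white := by
  change rdropBlack (dropWhite _) = _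
  rw [dropWhite_cons_black, List.replicate_succ', ← List.cons_append, rdropBlack_concat_white]

theorem ofRow_replicate_white_append (i j : ℕ) :
    ofRow (List.replicate i white ++ black :: List.replicate j white) = bw j := by
  refine ext_stones ?_
  change rdropBlack (dropWhite _) = rdropBlack (dropWhite _)
  induction i with
  | zero => rfl
  | succ i ih => rw [List.replicate_succ, List.cons_append, dropWhite_cons_white, ih]

theorem excess_bw_succ (k : ℕ) : (bw (k + 1)).excess = k := by
  rw [excess_eq, bw_succ_stones]
  simp [rowExcess, List.count_replicate]

theorem excess_bw_zero : (bw 0).excess = 0 := rfl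

theorem bw_stones_eq {k : ℕ} {a m b : List Stone}
    (h : (bw k).stones = a ++ black :: (m ++ white :: b)) :
    a = [] ∧ m = List.replicate m.length white ∧ b = List.replicate b.length white ∧
      k = m.length + b.length + 1 := by
  cases k with
  | zero => rw [bw_zero_stones] at h; simp at h
  | succ k =>
    rw [bw_succ_stones] at h
    cases a with
    | nil =>
      have h2 := (List.cons.inj h).2
      symm at h2
      rw [List.append_eq_replicate_iff] at h2
      obtain ⟨h3, h4, h5⟩ := h2
      refine ⟨rfl, h4, ?_, ?_⟩
      · rw [List.length_cons, List.replicate_succ] at h5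
        exact (List.cons.inj h5).2
      · rw [List.length_cons] at h3; omega
    | cons c a =>
      have h2 := (List.cons.inj h).2
      have : black ∈ List.replicate (k + 1) white := by rw [h2]; simp
      exact absurd (List.eq_of_mem_replicate this) (by simp)

/-- The white stones to the left of the moved black stone die. With no second black stone in the
way, Left can choose how many; Right reaches only the nearest white stone, whence
`rightMove_bw_iff`. -/
theorem leftMove_bw_iff {k : ℕ} {t : Strip} : LeftMove (bw k) t ↔ ∃ j < k, t = bw j := by
  constructor
  · rintro ⟨a, m, b, hs, -, rfl⟩
    obtain ⟨rfl, hm, hb, rfl⟩ := bw_stones_eq hs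
    refine ⟨b.length, by omega, ?_⟩
    rw [hm, hb, ← ofRow_replicate_white_append (m.length + 1)]
    simp [List.replicate_succ]
  · rintro ⟨j, hj, rfl⟩
    obtain ⟨i, rfl⟩ : ∃ i, k = i + j + 1 := ⟨k - j - 1, by omega⟩
    refine ⟨[], List.replicate i white, List.replicate j white, ?_, by simp, ?_⟩
    · rw [bw_succ_stones, List.nil_append, add_assoc, ← List.replicate_append_replicate,
        List.replicate_succ]
    · rw [← ofRow_replicate_white_append (i + 1)]
      simp [List.replicate_succ]

theorem rightMove_bw_iff {k : ℕ} {t : Strip} :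
    RightMove (bw k) t ↔ ∃ j, k = j + 1 ∧ t = bw j := by
  constructor
  · rintro ⟨a, m, b, hs, hm', rfl⟩
    obtain ⟨rfl, hm, hb, rfl⟩ := bw_stones_eq hs
    have : m = [] := by
      cases m with
      | nil => rfl
      | cons c m => rw [List.length_cons, List.replicate_succ] at hm; simp [hm] at hm'
    subst this
    refine ⟨b.length, by simp, ?_⟩
    rw [hb, ← ofRow_replicate_white_append 1]
    simp
  · rintro ⟨j, rfl, rfl⟩
    refine ⟨[], [], List.replicate j white, ?_, by simp, ?_⟩
    · rw [bw_succ_stones, List.replicate_succ]; rfl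
    · rw [← ofRow_replicate_white_append 1]; rfl

theorem isLeftOption_bw {k : ℕ} {z : Game} :
    IsLeftOption z (bw k).toGame ↔ ∃ j < k, z = (bw j).toGame := by
  rw [isLeftOption_toGame]
  simp only [leftMove_bw_iff]
  exact ⟨fun ⟨_, ⟨j, hj, rfl⟩, h⟩ => ⟨j, hj, h⟩, fun ⟨j, hj, h⟩ => ⟨_, ⟨j, hj, rfl⟩, h⟩⟩

theorem isRightOption_bw {k : ℕ} {z : Game} :
    IsRightOption z (bw k).toGame ↔ ∃ j, k = j + 1 ∧ z = (bw j).toGame := by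
  rw [isRightOption_toGame]
  simp only [rightMove_bw_iff]
  exact ⟨fun ⟨_, ⟨j, hj, rfl⟩, h⟩ => ⟨j, hj, h⟩, fun ⟨j, hj, h⟩ => ⟨_, ⟨j, hj, rfl⟩, h⟩⟩

theorem val_bw_zero : val (bw 0).toGame = 0 := by
  refine le_antisymm (val_le_zero_iff.2 fun x' h => ?_) (zero_le_val_iff.2 fun x' h => ?_)
  · obtain ⟨k, hk, -⟩ := isLeftOption_bw.1 h
    exact absurd hk (Nat.not_lt_zero k)
  · obtain ⟨k, hk, -⟩ := isRightOption_bw.1 h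
    omega

theorem val_bw_one : val (bw 1).toGame = val star := by
  have h0 : val (bw 0).toGame = val 0 := val_bw_zero
  refine le_antisymm (val_le_val_iff.2 ⟨?_, ?_⟩) (val_le_val_iff.2 ⟨?_, ?_⟩)
  · rintro _ hz
    obtain ⟨j, hj, rfl⟩ := isLeftOption_bw.1 hz
    rw [Nat.lt_one_iff.1 hj, h0]
    exact IsLeftOption.not_val_le ⟨(), rfl⟩
  · rintro _ ⟨-, rfl⟩
    rw [← h0]
    exact IsRightOption.not_val_le (isRightOption_bw.2 ⟨0, rfl, rfl⟩)
  · rintro _ ⟨-, rfl⟩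
    rw [← h0]
    exact IsLeftOption.not_val_le (isLeftOption_bw.2 ⟨0, one_pos, rfl⟩)
  · rintro _ hz
    obtain ⟨j, hj, rfl⟩ := isRightOption_bw.1 hz
    obtain rfl : j = 0 := by omega
    rw [h0]
    exact IsRightOption.not_val_le ⟨(), rfl⟩

theorem val_bw_two : val (bw 2).toGame = val up := by
  have h0 : val (bw 0).toGame = val 0 := val_bw_zero
  refine le_antisymm (val_le_val_iff.2 ⟨?_, ?_⟩) (val_le_val_iff.2 ⟨?_, ?_⟩)
  · rintro _ hz
    obtain ⟨j, hj, rfl⟩ := isLeftOption_bw.1 hz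
    obtain rfl | rfl : j = 0 ∨ j = 1 := by omega
    · rw [h0]
      exact IsLeftOption.not_val_le ⟨(), rfl⟩
    · rw [val_bw_one]
      -- The strip is {0, * | *}; its additional Left option * is reversible, as Right answers with
      -- 0 ≤ ↑.
      refine fun hc => IsRightOption.not_le (x' := 0) (x := star) ⟨(), rfl⟩ hc ?_
      exact zero_le_val_iff.2 (by
        rintro _ ⟨-, rfl⟩
        exact IsLeftOption.not_val_le (x' := 0) (x := star) ⟨(), rfl⟩)
  · rintro _ ⟨-, rfl⟩
    rw [← val_bw_one]
    exact IsRightOption.not_val_le (isRightOption_bw.2 ⟨1, rfl, rfl⟩)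
  · rintro _ ⟨-, rfl⟩
    rw [← h0]
    exact IsLeftOption.not_val_le (isLeftOption_bw.2 ⟨0, two_pos, rfl⟩)
  · rintro _ hz
    obtain ⟨j, hj, rfl⟩ := isRightOption_bw.1 hz
    obtain rfl : j = 1 := by omega
    rw [val_bw_one]
    exact IsRightOption.not_val_le ⟨(), rfl⟩

theorem val_bw_of_le_one {k : ℕ} (hk : k ≤ 1) : val (bw k).toGame = val (nim k) := by
  obtain rfl | rfl : k = 0 ∨ k = 1 := by omega
  · rw [val_bw_zero, val_nim_zero]
  · rw [val_bw_one, val_star]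

theorem eq_append_black_of_mem {l : List Stone} (h : black ∈ l) :
    ∃ x k, l = x ++ black :: List.replicate k white := by
  induction l using List.reverseRecOn with
  | nil => simp at h
  | append_singleton l c ih =>
    cases c
    · exact ⟨l, 0, rfl⟩
    · obtain ⟨x, k, rfl⟩ := ih (by simpa using h)
      exact ⟨x, k + 1, by simp [List.replicate_succ']⟩

/-- Unless a strip has at most one black stone, Left has a move that removes just one stone, and
that a black one. -/
theorem exists_leftMove_excess (s : Strip) :
    (∃ k, s = bw k) ∨ ∃ t, LeftMove s t ∧ s.excess + 1 ≤ t.excess := by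
  by_cases hb : black ∈ s.stones
  · obtain ⟨x, k, hs⟩ := eq_append_black_of_mem hb
    have halive := s.alive
    rw [hs] at halive
    cases x with
    | nil =>
      left
      exact ⟨k, by rw [← ofRow_stones s, hs]; rfl⟩
    | cons c x =>
      right
      cases k with
      | zero =>
        exact absurd (AllAlive.last_eq (l := c :: x) halive) (by simp)
      | succ k =>
        obtain rfl := AllAlive.head_eq halive
        -- Left exchanges the last black stone with the last white one, so that it dies at the right
        -- end; another black stone still heads the row, so no white stone dies.
        refine ⟨_, ⟨black :: x, List.replicate k white, [], ?_, by simp, rfl⟩, ?_⟩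
        · rw [hs, List.replicate_succ']
        · have e : (black :: x) ++ white :: (List.replicate k white ++ [black]) =
              ((black :: x) ++ List.replicate (k + 1) white) ++ [black] := by
            simp [List.replicate_succ]
          rw [excess_eq, excess_eq, e, hs]
          change _ ≤ rowExcess (rdropBlack (dropWhite _))
          have e' : dropWhite ((black :: x ++ List.replicate (k + 1) white) ++ [black]) =
            (black :: x ++ List.replicate (k + 1) white) ++ [black] := dropWhite_cons_black _
          rw [e', rdropBlack_concat_black]
          refine le_trans (le_of_eq ?_) (rowExcess_le_rdropBlack _)
          simp only [rowExcess_append, rowExcess_cons_black, List.cons_append]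
          ring
  · left
    refine ⟨0, ext_stones ?_⟩
    rw [bw_zero_stones]
    have halive := s.alive
    rcases hs : s.stones with - | ⟨c, l⟩
    · rfl
    · rw [hs] at halive hb
      obtain rfl := AllAlive.head_eq halive
      simp at hb

end Strip

/-! ### Sums of strips -/

open Game Strip

theorem bipassSum_cons (s : Strip) (g : List Strip) :
    bipassSum (s :: g) = s.toGame + bipassSum g := rfl

theorem bipassExcess_cons (s : Strip) (g : List Strip) :
    bipassExcess (s :: g) = s.excess + bipassExcess g := rfl

theorem bipassExcess_append (g h : List Strip) :
    bipassExcess (g ++ h) = bipassExcess g + bipassExcess h := by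
  simp [bipassExcess]

theorem val_bipassSum_append (g h : List Strip) :
    val (bipassSum (g ++ h)) = val (bipassSum g) + val (bipassSum h) := by
  induction g with
  | nil => exact (zero_add _).symm
  | cons s g ih => rw [List.cons_append, bipassSum_cons, bipassSum_cons, val_add, val_add, ih,
      add_assoc]

theorem isLeftOption_bipassSum {g : List Strip} {z : Game} : IsLeftOption z (bipassSum g) ↔
    ∃ a s b t, g = a ++ s :: b ∧ LeftMove s t ∧ z = bipassSum (a ++ t :: b) := by
  induction g generalizing z with
  | nil =>
    refine iff_of_false (not_isLeftOption_zero z) ?_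
    rintro ⟨a, s, b, t, h, -⟩
    simp at h
  | cons s g ih =>
    rw [bipassSum_cons, isLeftOption_add]
    simp only [ih, isLeftOption_toGame]
    constructor
    · rintro (⟨_, ⟨t, ht, rfl⟩, rfl⟩ | ⟨_, ⟨a, s', b, t, rfl, ht, rfl⟩, rfl⟩)
      · exact ⟨[], s, g, t, rfl, ht, rfl⟩
      · exact ⟨s :: a, s', b, t, rfl, ht, rfl⟩
    · rintro ⟨a, s', b, t, h, ht, rfl⟩
      cases a with
      | nil =>
        obtain ⟨rfl, rfl⟩ := List.cons.inj h
        exact Or.inl ⟨_, ⟨t, ht, rfl⟩, rfl⟩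
      | cons s'' a =>
        obtain ⟨rfl, rfl⟩ := List.cons.inj h
        exact Or.inr ⟨_, ⟨a, s', b, t, rfl, ht, rfl⟩, rfl⟩

theorem isRightOption_bipassSum {g : List Strip} {z : Game} : IsRightOption z (bipassSum g) ↔
    ∃ a s b t, g = a ++ s :: b ∧ RightMove s t ∧ z = bipassSum (a ++ t :: b) := by
  induction g generalizing z with
  | nil =>
    refine iff_of_false (not_isRightOption_zero z) ?_
    rintro ⟨a, s, b, t, h, -⟩
    simp at h
  | cons s g ih =>
    rw [bipassSum_cons, isRightOption_add]
    simp only [ih, isRightOption_toGame]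
    constructor
    · rintro (⟨_, ⟨t, ht, rfl⟩, rfl⟩ | ⟨_, ⟨a, s', b, t, rfl, ht, rfl⟩, rfl⟩)
      · exact ⟨[], s, g, t, rfl, ht, rfl⟩
      · exact ⟨s :: a, s', b, t, rfl, ht, rfl⟩
    · rintro ⟨a, s', b, t, h, ht, rfl⟩
      cases a with
      | nil =>
        obtain ⟨rfl, rfl⟩ := List.cons.inj h
        exact Or.inl ⟨_, ⟨t, ht, rfl⟩, rfl⟩
      | cons s'' a =>
        obtain ⟨rfl, rfl⟩ := List.cons.inj h
        exact Or.inr ⟨_, ⟨a, s', b, t, rfl, ht, rfl⟩, rfl⟩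

theorem isShort_bipassSum (g : List Strip) : (bipassSum g).IsShort := by
  induction g with
  | nil => exact isShort_zero
  | cons s g ih => exact s.isShort_toGame.add ih

theorem isAllSmall_bipassSum (g : List Strip) : (bipassSum g).IsAllSmall := by
  induction g with
  | nil => exact isAllSmall_zero
  | cons s g ih => exact s.isAllSmall_toGame.add ih

theorem val_bipassSum_map_mirror (g : List Strip) :
    val (bipassSum (g.map mirror)) = -val (bipassSum g) := by
  induction g with
  | nil => exact neg_zero.symm
  | cons s g ih =>
    rw [List.map_cons, bipassSum_cons, bipassSum_cons, val_add, val_add, ih, val_mirror, neg_add]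

theorem bipassExcess_map_mirror (g : List Strip) :
    bipassExcess (g.map mirror) = -bipassExcess g := by
  induction g with
  | nil => rfl
  | cons s g ih =>
    rw [List.map_cons, bipassExcess_cons, bipassExcess_cons, ih, mirror_excess, neg_add]

/-! ### Strips with a single black stone -/

theorem exists_odd_of_odd_sum {ks : List ℕ} (h : Odd ks.sum) : ∃ k ∈ ks, Odd k := by
  by_contra! hc
  refine Nat.not_even_iff_odd.2 h (even_iff_two_dvd.2 (List.dvd_sum fun k hk => ?_))
  exact even_iff_two_dvd.1 (Nat.not_odd_iff_even.1 (hc k hk))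

theorem not_bw_sum_le_zero_of_lt {l₁ l₂ : List ℕ} {j k : ℕ} (hj : j < k)
    (h : 0 ≤ val (bipassSum ((l₁ ++ j :: l₂).map bw))) :
    ¬ val (bipassSum ((l₁ ++ k :: l₂).map bw)) ≤ 0 := by
  refine not_val_le_zero_iff.2 ⟨_, isLeftOption_bipassSum.2
    ⟨l₁.map bw, bw k, l₂.map bw, bw j, by simp, leftMove_bw_iff.2 ⟨j, hj, rfl⟩, rfl⟩, ?_⟩
  simpa using h

/-- Right must lower one number by 1. The sum is then odd, hence some number is odd, and Left
restores an even sum by lowering that one by 1. -/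
theorem zero_le_bw_sum {ks : List ℕ} (h : Even ks.sum) : 0 ≤ val (bipassSum (ks.map bw)) := by
  induction hn : ks.sum using Nat.strong_induction_on generalizing ks with
  | _ n ih =>
  subst hn
  refine zero_le_val_iff.2 fun z hz => ?_
  obtain ⟨a, s, b, t, hks, ht, rfl⟩ := isRightOption_bipassSum.1 hz
  obtain ⟨l₁, l, rfl, rfl, hl⟩ := List.map_eq_append_iff.1 hks
  obtain ⟨k, l₂, rfl, rfl, rfl⟩ := List.map_eq_cons_iff.1 hl
  obtain ⟨j, rfl, rfl⟩ := rightMove_bw_iff.1 ht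
  have hodd : Odd (l₁ ++ j :: l₂).sum := by
    rw [← Nat.not_even_iff_odd]
    simp only [List.sum_append, List.sum_cons] at h ⊢
    intro h'
    rw [Nat.even_iff] at h h'
    omega
  have hlt : (l₁ ++ j :: l₂).sum < (l₁ ++ (j + 1) :: l₂).sum := by simp
  rw [← List.map_cons, ← List.map_append]
  generalize l₁ ++ j :: l₂ = l at hodd hlt
  obtain ⟨k, hk, hkodd⟩ := exists_odd_of_odd_sum hodd
  obtain ⟨l₃, l₄, rfl⟩ := List.append_of_mem hk
  obtain ⟨i, rfl⟩ := hkodd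
  refine not_bw_sum_le_zero_of_lt (Nat.lt_succ_self (2 * i)) (ih _ ?_ ?_ rfl)
  · refine lt_trans ?_ hlt
    simp
  · rw [Nat.odd_iff] at hodd
    rw [Nat.even_iff]
    simp only [List.sum_append, List.sum_cons] at hodd ⊢
    omega

/-- Left can lower `k` by 1 or by 2, and one of these leaves an even sum. -/
theorem not_bw_sum_le_zero {ks : List ℕ} {k : ℕ} (hk : k ∈ ks) (h2 : 2 ≤ k) :
    ¬ val (bipassSum (ks.map bw)) ≤ 0 := by
  obtain ⟨l₁, l₂, rfl⟩ := List.append_of_mem hk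
  rcases Nat.even_or_odd (l₁ ++ (k - 1) :: l₂).sum with h | h
  · exact not_bw_sum_le_zero_of_lt (by omega) (zero_le_bw_sum h)
  · refine not_bw_sum_le_zero_of_lt (j := k - 2) (by omega) (zero_le_bw_sum ?_)
    rw [Nat.odd_iff] at h
    rw [Nat.even_iff]
    simp only [List.sum_append, List.sum_cons] at h ⊢
    omega

theorem exists_two_le_of_bipassExcess_pos {ks : List ℕ} (h : 1 ≤ bipassExcess (ks.map bw)) :
    ∃ k ∈ ks, 2 ≤ k := by
  by_contra! hc
  have : bipassExcess (ks.map bw) ≤ 0 := by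
    clear h
    induction ks with
    | nil => exact le_rfl
    | cons k ks ih =>
      rw [List.map_cons, bipassExcess_cons]
      have h1 := ih fun k hk => hc k (List.mem_cons_of_mem _ hk)
      have h2 := hc k List.mem_cons_self
      obtain rfl | rfl : k = 0 ∨ k = 1 := by omega
      · rw [excess_bw_zero]; omega
      · rw [excess_bw_succ 0]; simpa using h1
  omega

/-- The heaps `*0` and `*1` have the values of `bw 0` and `bw 1`, so one of them makes the sum even.
-/
theorem exists_nim_zero_le_bw_sum (ks : List ℕ) :
    ∃ e ≤ 1, 0 ≤ val (bipassSum (ks.map bw)) + val (nim e) := by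
  refine ⟨ks.sum % 2, by omega, ?_⟩
  rw [← val_bw_of_le_one (by omega), add_comm]
  refine zero_le_bw_sum (ks := (ks.sum % 2) :: ks) ?_
  rw [Nat.even_iff, List.sum_cons]
  omega

/-! ### Winning bipass sums -/

theorem exists_leftMove_or_eq_map_bw (g : List Strip) : (∃ ks : List ℕ, g = ks.map bw) ∨
    ∃ a s b t, g = a ++ s :: b ∧ LeftMove s t ∧ s.excess + 1 ≤ t.excess := by
  induction g with
  | nil => exact Or.inl ⟨[], rfl⟩
  | cons s g ih =>
    rcases ih with ⟨ks, rfl⟩ | ⟨a, s', b, t, rfl, h⟩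
    · rcases s.exists_leftMove_excess with ⟨k, rfl⟩ | ⟨t, h⟩
      · exact Or.inl ⟨k :: ks, rfl⟩
      · exact Or.inr ⟨[], s, _, t, rfl, h⟩
    · exact Or.inr ⟨s :: a, s', b, t, rfl, h⟩

/-- The length of play on a sum of strips is bounded by this number. -/
def totalInv (g : List Strip) : ℕ := (g.map fun s => inv s.stones).sum

theorem totalInv_lt {a b : List Strip} {s t : Strip} (h : inv t.stones < inv s.stones) :
    totalInv (a ++ t :: b) < totalInv (a ++ s :: b) := by
  simp [totalInv, h]

theorem bipassExcess_replace (a b : List Strip) (s t : Strip) :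
    bipassExcess (a ++ t :: b) = bipassExcess (a ++ s :: b) + t.excess - s.excess := by
  simp only [bipassExcess_append, bipassExcess_cons]; ring

/-- Left's gain of 1 leads from the first clause to the second, and Right's gain of at most 1 leads
back. The first clause is settled by parity when no strip has two black stones. -/
theorem bipassSum_add_nim (g : List Strip) (n : ℕ) :
    (1 ≤ bipassExcess g → ¬ val (bipassSum g) + val (nim n) ≤ 0) ∧
      (2 ≤ bipassExcess g → 0 ≤ val (bipassSum g) + val (nim n)) := by
  induction hi : totalInv g using Nat.strong_induction_on generalizing g n with
  | _ i ih =>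
  subst hi
  have first : ∀ n, 1 ≤ bipassExcess g → ¬ val (bipassSum g) + val (nim n) ≤ 0 := by
    intro n hg
    rcases exists_leftMove_or_eq_map_bw g with ⟨ks, rfl⟩ | ⟨a, s, b, t, rfl, ht, he⟩
    · rcases le_or_gt n 1 with hn | hn
      · obtain ⟨k, hk, hk2⟩ := exists_two_le_of_bipassExcess_pos hg
        rw [← val_bw_of_le_one hn, add_comm]
        exact not_bw_sum_le_zero (ks := n :: ks) (List.mem_cons_of_mem _ hk) hk2
      -- Here `n ≥ 2`, so Left can lower the heap to whichever of `*0`, `*1` fixes the parity.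
      · obtain ⟨e, he, h⟩ := exists_nim_zero_le_bw_sum ks
        exact not_val_le_zero_iff (x := _ + nim n).2
          ⟨_, (isLeftOption_nim.2 ⟨e, by omega, rfl⟩).add_left _, h⟩
    · refine not_val_le_zero_iff (x := _ + nim n).2
        ⟨_, (isLeftOption_bipassSum.2 ⟨a, s, b, t, rfl, ht, rfl⟩).add_right _, ?_⟩
      refine (ih _ (totalInv_lt ht.inv_lt) _ n rfl).2 ?_
      rw [bipassExcess_replace a b s t]
      omega
  refine ⟨first n, fun hg => zero_le_val_iff (x := _ + nim n).2 fun z hz => ?_⟩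
  rcases isRightOption_add.1 hz with ⟨y, hy, rfl⟩ | ⟨y, hy, rfl⟩
  · obtain ⟨a, s, b, t, rfl, ht, rfl⟩ := isRightOption_bipassSum.1 hy
    refine (ih _ (totalInv_lt ht.inv_lt) _ n rfl).1 ?_
    have := ht.excess_le
    rw [bipassExcess_replace a b s t]
    omega
  · obtain ⟨k, -, rfl⟩ := isRightOption_nim.1 hy
    exact first k (by omega)

/-- The thresholds are one lower than in `bipassSum_add_nim`: in the parity ending Left can always
move ☆ to the heap that is needed. -/
theorem bipassSum_add_farStar (g : List Strip) :
    (0 ≤ bipassExcess g → ¬ val (bipassSum g) + val farStar ≤ 0) ∧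
      (1 ≤ bipassExcess g → 0 ≤ val (bipassSum g) + val farStar) := by
  induction hi : totalInv g using Nat.strong_induction_on generalizing g with
  | _ i ih =>
  subst hi
  constructor
  · intro hg
    rcases exists_leftMove_or_eq_map_bw g with ⟨ks, rfl⟩ | ⟨a, s, b, t, rfl, ht, he⟩
    · obtain ⟨e, he, h⟩ := exists_nim_zero_le_bw_sum ks
      exact not_val_le_zero_iff (x := _ + farStar).2
        ⟨_, (isLeftOption_farStar.2 ⟨e, rfl⟩).add_left _, h⟩
    · refine not_val_le_zero_iff (x := _ + farStar).2
        ⟨_, (isLeftOption_bipassSum.2 ⟨a, s, b, t, rfl, ht, rfl⟩).add_right _, ?_⟩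
      refine (ih _ (totalInv_lt ht.inv_lt) _ rfl).2 ?_
      rw [bipassExcess_replace a b s t]
      omega
  · refine fun hg => zero_le_val_iff (x := _ + farStar).2 fun z hz => ?_
    rcases isRightOption_add.1 hz with ⟨y, hy, rfl⟩ | ⟨y, hy, rfl⟩
    · obtain ⟨a, s, b, t, rfl, ht, rfl⟩ := isRightOption_bipassSum.1 hy
      refine (ih _ (totalInv_lt ht.inv_lt) _ rfl).1 ?_
      have := ht.excess_le
      rw [bipassExcess_replace a b s t]
      omega
    · obtain ⟨k, rfl⟩ := isRightOption_farStar.1 hy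
      exact (bipassSum_add_nim g k).1 hg

/-- Copies of `bw 2` or of its mirror image realize the multiples of ↑ with matching excess, so
bounds for bipass sums also cover their sums with multiples of ↑. -/
theorem exists_bipassSum_eq_zsmul_up (m : ℤ) :
    ∃ g, bipassExcess g = m ∧ val (bipassSum g) = m • val up := by
  have key : ∀ n : ℕ, bipassExcess (List.replicate n (bw 2)) = n ∧
      val (bipassSum (List.replicate n (bw 2))) = n • val up := by
    intro n
    induction n with
    | zero => exact ⟨rfl, (zero_nsmul _).symm⟩
    | succ n ih =>
      rw [List.replicate_succ, bipassExcess_cons, bipassSum_cons, val_add, ih.1, ih.2,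
        excess_bw_succ 1, val_bw_two, succ_nsmul']
      exact ⟨by push_cast; ring, rfl⟩
  obtain ⟨n, rfl | rfl⟩ := m.eq_nat_or_neg
  · exact ⟨_, (key n).1, by rw [natCast_zsmul]; exact (key n).2⟩
  · refine ⟨(List.replicate n (bw 2)).map mirror, ?_, ?_⟩
    · rw [bipassExcess_map_mirror, (key n).1]
    · rw [val_bipassSum_map_mirror, (key n).2, neg_zsmul, natCast_zsmul]

theorem zero_le_bipassSum_add_zsmul_up_add_farStar {g : List Strip} {m : ℤ}
    (h : 1 ≤ bipassExcess g + m) : 0 ≤ val (bipassSum g) + m • val up + val farStar := by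
  obtain ⟨r, hr, hr'⟩ := exists_bipassSum_eq_zsmul_up m
  rw [← hr', ← val_bipassSum_append]
  exact (bipassSum_add_farStar _).2 (by rw [bipassExcess_append, hr]; exact h)

namespace Game

/-! ### Integers -/

theorem neg_ofNat (n : ℕ) : -ofNat n = negOfNat n := by
  induction n with
  | zero => exact neg_zero_game
  | succ n ih =>
    rw [ofNat, neg_mk, ih, negOfNat]
    congr 1
    exact funext fun i => i.elim

theorem val_ofInt_neg (n : ℤ) : val (ofInt (-n)) = -val (ofInt n) := by
  have key : ∀ n : ℕ, val (ofInt (-n)) = -val (ofInt n) := by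
    intro n
    cases n with
    | zero => exact neg_zero.symm
    | succ n => rw [← val_neg]; exact congrArg val (neg_ofNat (n + 1)).symm
  obtain ⟨n, rfl | rfl⟩ := n.eq_nat_or_neg
  · exact key n
  · rw [neg_neg, key, neg_neg]

theorem isLeftOption_ofInt {z : Game} {n : ℤ} :
    IsLeftOption z (ofInt n) ↔ 0 < n ∧ z = ofInt (n - 1) := by
  rcases n with (_ | n) | n
  · refine iff_of_false (not_isLeftOption_zero z) ?_
    simp
  · have e : Int.ofNat (n + 1) - 1 = Int.ofNat n := by simp
    rw [e]
    exact ⟨fun ⟨_, h⟩ => ⟨by simp, h⟩, fun h => ⟨(), h.2⟩⟩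
  · refine iff_of_false (fun ⟨i, _⟩ => i.elim) fun h => ?_
    have := Int.negSucc_lt_zero n
    omega

theorem isRightOption_ofInt {z : Game} {n : ℤ} :
    IsRightOption z (ofInt n) ↔ n < 0 ∧ z = ofInt (n + 1) := by
  rcases n with (_ | n) | n
  · refine iff_of_false (not_isRightOption_zero z) ?_
    simp
  · refine iff_of_false (fun ⟨i, _⟩ => i.elim) fun h => ?_
    have := Int.natCast_nonneg (n + 1)
    exact absurd h.1 (by simpa using this)
  · have e : ofInt (Int.negSucc n + 1) = negOfNat n := by
      cases n <;> rfl
    rw [e]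
    exact ⟨fun ⟨_, h⟩ => ⟨Int.negSucc_lt_zero n, h⟩, fun h => ⟨(), h.2⟩⟩

theorem val_ofInt_strictMono : StrictMono fun n => val (ofInt n) := by
  have key : ∀ n : ℕ, val (ofInt n) < val (ofInt (n + 1)) := by
    intro n
    have h : ∀ n : ℕ, ¬ val (ofInt (n + 1)) ≤ val (ofInt n) := fun n =>
      IsLeftOption.not_val_le (isLeftOption_ofInt.2 ⟨by omega, by rw [add_sub_cancel_right]⟩)
    induction n with
    | zero =>
      refine lt_of_le_not_ge (val_le_val_iff.2 ⟨fun z hz => ?_, fun z hz => ?_⟩) (h _)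
      · have := (isLeftOption_ofInt.1 hz).1
        omega
      · have := (isRightOption_ofInt.1 hz).1
        omega
    | succ n ih =>
      refine lt_of_le_not_ge (val_le_val_iff.2 ⟨fun z hz => ?_, fun z hz => ?_⟩) (h _)
      · rw [(isLeftOption_ofInt.1 hz).2]
        intro hc
        refine h (n + 1) (hc.trans ?_)
        push_cast
        rw [add_sub_cancel_right]
        exact ih.le
      · have := (isRightOption_ofInt.1 hz).1
        omega
  refine strictMono_int_of_lt_succ fun n => ?_
  rcases n with n | n
  · exact key n
  · have h := neg_lt_neg (key n)
    rw [← val_ofInt_neg, ← val_ofInt_neg] at h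
    have e : Int.negSucc n = -((n : ℤ) + 1) := by simp [Int.negSucc_eq]
    rw [e]
    simpa using h

theorem isShort_ofInt (n : ℤ) : (ofInt n).IsShort := by
  have key : ∀ n : ℕ, (ofNat n).IsShort := by
    intro n
    induction n with
    | zero => exact isShort_zero
    | succ n ih => exact isShort_mk.2 ⟨inferInstance, inferInstance, fun _ => ih, fun i => i.elim⟩
  rcases n with n | n
  · exact key n
  · rw [ofInt, ← neg_ofNat]
    exact (key _).neg

theorem equiv_of_val_eq {x y : Game} (h : val x = val y) : Equiv x y := by
  intro z _
  rw [outcome_eq_iff, val_add, val_add, h]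
  exact ⟨Iff.rfl, Iff.rfl⟩

/-- `Equiv` tests against short games only; the short game `-ofInt n` already suffices to compare
with `ofInt n`. -/
theorem equiv_ofInt_iff {x : Game} {n : ℤ} : Equiv x (ofInt n) ↔ val x = val (ofInt n) := by
  refine ⟨fun h => ?_, equiv_of_val_eq⟩
  have := h (-ofInt n) (isShort_ofInt n).neg
  rw [outcome_eq_iff, val_add, val_add, val_neg, add_neg_cancel, ← sub_eq_add_neg, sub_nonneg,
    sub_nonpos] at this
  exact le_antisymm (this.2.2 le_rfl) (this.1.2 le_rfl)

/-- A game is an integer if some integer fits strictly between its Left and Right options. -/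
theorem exists_val_eq_ofInt {x : Game} (j : ℤ)
    (hL : ∀ x', IsLeftOption x' x → ¬ val (ofInt j) ≤ val x')
    (hR : ∀ x', IsRightOption x' x → ¬ val x' ≤ val (ofInt j)) :
    ∃ n : ℤ, val x = val (ofInt n) := by
  induction hj : j.natAbs using Nat.strong_induction_on generalizing j with
  | _ i ih =>
  subst hj
  by_cases h : val x = val (ofInt j)
  · exact ⟨j, h⟩
  rw [le_antisymm_iff, not_and_or] at h
  rcases h with h | h
  · rw [val_le_val_iff, not_and_or] at h
    push Not at h
    rcases h with ⟨x', hx', h⟩ | ⟨z, hz, h⟩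
    · exact (hL x' hx' h).elim
    · obtain ⟨hj, rfl⟩ := isRightOption_ofInt.1 hz
      -- The failing inequality produces an option of `j` that also fits strictly between the
      -- options of `x` and is closer to 0.
      refine ih _ (by omega) (j + 1) (fun x' hx' hc => ?_) (fun x' hx' hc => ?_) rfl
      · exact hL x' hx' ((val_ofInt_strictMono (by omega : j < j + 1)).le.trans hc)
      · exact hx'.not_val_le (hc.trans h)
  · rw [val_le_val_iff, not_and_or] at h
    push Not at h
    rcases h with ⟨z, hz, h⟩ | ⟨x', hx', h⟩
    · obtain ⟨hj, rfl⟩ := isLeftOption_ofInt.1 hz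
      refine ih _ (by omega) (j - 1) (fun x' hx' hc => ?_) (fun x' hx' hc => ?_) rfl
      · exact hx'.not_val_le (h.trans hc)
      · exact hR x' hx' (hc.trans (val_ofInt_strictMono (by omega : j - 1 < j)).le)
    · exact (hR x' hx' h).elim

theorem exists_rightOption_le_ofInt {x : Game} (hx : ¬ ∃ n : ℤ, val x = val (ofInt n)) {k : ℤ}
    (h : ¬ val (ofInt k) ≤ val x) : ∃ x', IsRightOption x' x ∧ val x' ≤ val (ofInt k) := by
  by_contra! hc
  rw [val_le_val_iff, not_and_or] at h
  push Not at h
  rcases h with ⟨z, hz, h⟩ | ⟨x', hx', h⟩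
  · obtain ⟨-, rfl⟩ := isLeftOption_ofInt.1 hz
    -- Here x ≤ k − 1. Were no Right option at most k, the integer k − 1 would fit between the
    -- options and `x` would be an integer.
    refine hx (exists_val_eq_ofInt (k - 1) (fun x' hx' h' => ?_) (fun x' hx' h' => ?_))
    · exact hx'.not_val_le (h.trans h')
    · exact hc x' hx' (h'.trans (val_ofInt_strictMono (by omega : k - 1 < k)).le)
  · exact hc x' hx' h

/-! ### Multiples of `↑` -/

theorem val_copies (x : Game) (n : ℕ) : val (copies x n) = n • val x := by
  induction n with
  | zero => exact (zero_nsmul _).symm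
  | succ n ih => rw [copies, val_add, ih, succ_nsmul']

theorem val_intMulUp (m : ℤ) : val (intMulUp m) = m • val up := by
  rcases m with n | n
  · rw [intMulUp, val_copies]; exact (natCast_zsmul _ _).symm
  · rw [intMulUp, val_copies, val_down, negSucc_zsmul, smul_neg]

theorem isShort_copies {x : Game} (hx : x.IsShort) (n : ℕ) : (copies x n).IsShort := by
  induction n with
  | zero => exact isShort_zero
  | succ n ih => exact hx.add ih

theorem isShort_intMulUp (m : ℤ) : (intMulUp m).IsShort := by
  rcases m with n | n
  · exact isShort_copies isShort_up n
  · exact isShort_copies isShort_down _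

theorem IsLeftOption.val_copies {x z : Game} {n : ℕ} (h : IsLeftOption z (copies x n)) :
    ∃ x', IsLeftOption x' x ∧ val z = val x' - val x + n • val x := by
  induction n generalizing z with
  | zero => exact (not_isLeftOption_zero _ h).elim
  | succ n ih =>
    rw [copies, isLeftOption_add] at h
    rcases h with ⟨x', hx', rfl⟩ | ⟨z', hz', rfl⟩
    · refine ⟨x', hx', ?_⟩
      rw [val_add, Game.val_copies, succ_nsmul]
      abel
    · obtain ⟨x', hx', h⟩ := ih hz'
      refine ⟨x', hx', ?_⟩
      rw [val_add, h, succ_nsmul]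
      abel

theorem IsLeftOption.val_intMulUp {z : Game} {m : ℤ} (h : IsLeftOption z (intMulUp m)) :
    val z = (m - 1) • val up ∨ val z = (m + 1) • val up + val (nim 1) := by
  rcases m with n | n
  · left
    obtain ⟨_, ⟨_, rfl⟩, hv⟩ := IsLeftOption.val_copies (x := up) (n := n) h
    rw [hv, val_zero, sub_zsmul, one_zsmul, Int.ofNat_eq_natCast, natCast_zsmul]
    abel
  · right
    obtain ⟨_, ⟨_, rfl⟩, hv⟩ := IsLeftOption.val_copies (x := down) (n := n + 1) h
    rw [hv, val_down, val_star, add_zsmul, one_zsmul, negSucc_zsmul, smul_neg]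
    abel

theorem val_mulUp_of_eq {x : Game} {n : ℤ} (h : val x = val (ofInt n)) :
    val (mulUp x) = n • val up := by
  cases x with
  | mk α β L R =>
    have hex : ∃ n : ℤ, Equiv (mk α β L R) (ofInt n) := ⟨n, equiv_ofInt_iff.2 h⟩
    rw [mulUp, dif_pos hex, val_intMulUp]
    congr 1
    exact val_ofInt_strictMono.injective ((equiv_ofInt_iff.1 hex.choose_spec).symm.trans h)

theorem mulUp_of_not {α β : Type} {L : α → Game} {R : β → Game}
    (h : ¬ ∃ n : ℤ, val (mk α β L R) = val (ofInt n)) :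
    mulUp (mk α β L R) = mk α β (fun i => mulUp (L i) + (up + up + star))
      (fun j => mulUp (R j) + (down + down + star)) := by
  have : ¬ ∃ n : ℤ, Equiv (mk α β L R) (ofInt n) := by simpa only [equiv_ofInt_iff] using h
  rw [mulUp, dif_neg this]

theorem isLeftOption_mulUp {x z : Game} (h : ¬ ∃ n : ℤ, val x = val (ofInt n)) :
    IsLeftOption z (mulUp x) ↔
      ∃ x', IsLeftOption x' x ∧ z = mulUp x' + (up + up + star) := by
  cases x with
  | mk α β L R =>
    rw [mulUp_of_not h]
    exact ⟨fun ⟨i, h⟩ => ⟨_, ⟨i, rfl⟩, h⟩, fun ⟨_, ⟨i, h'⟩, h⟩ => ⟨i, by rw [h, h']⟩⟩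

theorem isRightOption_mulUp {x z : Game} (h : ¬ ∃ n : ℤ, val x = val (ofInt n)) :
    IsRightOption z (mulUp x) ↔
      ∃ x', IsRightOption x' x ∧ z = mulUp x' + (down + down + star) := by
  cases x with
  | mk α β L R =>
    rw [mulUp_of_not h]
    exact ⟨fun ⟨i, h⟩ => ⟨_, ⟨i, rfl⟩, h⟩, fun ⟨_, ⟨i, h'⟩, h⟩ => ⟨i, by rw [h, h']⟩⟩

theorem isShort_mulUp {x : Game} (hx : x.IsShort) : (mulUp x).IsShort := by
  induction x with
  | mk α β L R ihL ihR =>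
    have h := isShort_mk.1 hx
    rw [mulUp]
    split_ifs with hn
    · exact isShort_intMulUp _
    · exact isShort_mk.2 ⟨h.1, h.2.1,
        fun i => (ihL i (h.2.2.1 i)).add ((isShort_up.add isShort_up).add isShort_star),
        fun j => (ihR j (h.2.2.2 j)).add ((isShort_down.add isShort_down).add isShort_star)⟩

theorem val_mulUp_neg (x : Game) : val (mulUp (-x)) = -val (mulUp x) := by
  induction x with
  | mk α β L R ihL ihR =>
    by_cases h : ∃ n : ℤ, val (mk α β L R) = val (ofInt n)
    · obtain ⟨n, h⟩ := h
      rw [val_mulUp_of_eq h, val_mulUp_of_eq (n := -n), neg_zsmul]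
      rw [val_neg, h, val_ofInt_neg]
    · have h' : ¬ ∃ n : ℤ, val (-mk α β L R) = val (ofInt n) := by
        rintro ⟨n, hn⟩
        exact h ⟨-n, by rw [val_ofInt_neg, ← hn, val_neg, neg_neg]⟩
      rw [mulUp_of_not h, ← val_neg, neg_mk]
      rw [neg_mk] at h' ⊢
      rw [mulUp_of_not h']
      have hs : -val star = val star := by rw [val_star, neg_val_nim]
      refine val_congr (fun j => ?_) (fun i => ?_)
      · simp only [val_add, val_neg, neg_add, ihR, val_down, neg_neg, hs]
      · simp only [val_add, val_neg, neg_add, ihL, val_down, hs]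

/-! ### Multiples of `↑` and the far star -/

/-- Negating the bipass result for the sum that represents `-m • ↑` turns Left's bounds into
Right's. -/
theorem zsmul_up_add_farStar (m : ℤ) :
    (m ≤ -1 → m • val up + val farStar ≤ 0) ∧ (m ≤ 0 → ¬ 0 ≤ m • val up + val farStar) := by
  obtain ⟨r, hr, hr'⟩ := exists_bipassSum_eq_zsmul_up (-m)
  have h := bipassSum_add_farStar r
  rw [hr, hr', neg_zsmul, ← neg_val_farStar, ← neg_add,
    neg_nonneg (a := m • val up + _), Left.neg_nonpos_iff] at h
  exact ⟨fun hm => h.2 (by omega), fun hm => h.1 (by omega)⟩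

theorem zsmul_up_add_nim (m : ℤ) (a : ℕ) :
    (m ≤ -2 → m • val up + val (nim a) ≤ 0) ∧ (m ≤ -1 → ¬ 0 ≤ m • val up + val (nim a)) := by
  obtain ⟨r, hr, hr'⟩ := exists_bipassSum_eq_zsmul_up (-m)
  have h := bipassSum_add_nim r a
  rw [hr, hr', neg_zsmul, ← neg_val_nim, ← neg_add, neg_nonneg, Left.neg_nonpos_iff] at h
  exact ⟨fun hm => h.2 (by omega), fun hm => h.1 (by omega)⟩

theorem mulUp_add_farStar_add_nim_iff {x : Game} (hx : x.IsShort) (m : ℤ) (a : ℕ) :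
    (val (mulUp x) + m • val up + val farStar + val (nim a) ≤ 0 ↔
      val (mulUp x) + m • val up + val farStar ≤ 0) ∧
    (0 ≤ val (mulUp x) + m • val up + val farStar + val (nim a) ↔
      0 ≤ val (mulUp x) + m • val up + val farStar) := by
  have h := (isShort_mulUp hx).add (isShort_intMulUp m)
  rw [← val_intMulUp, ← val_add]
  exact ⟨add_farStar_add_nim_le_zero_iff h a, zero_le_add_farStar_add_nim_iff h a⟩

theorem mulUp_of_eq_ofInt {x : Game} (hx : ∃ n : ℤ, val x = val (ofInt n)) {k m : ℤ} :
    (m + k = -1 → val x ≤ val (ofInt k) → val (mulUp x) + m • val up + val farStar ≤ 0) ∧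
    (m + k = 1 → ¬ val (ofInt k) ≤ val x →
      ¬ 0 ≤ val (mulUp x) + m • val up + val farStar) ∧
    (m + k = -2 → val x ≤ val (ofInt k) →
      ∀ a, val (mulUp x) + m • val up + val (nim a) ≤ 0) ∧
    (m + k = 0 → ¬ val (ofInt k) ≤ val x →
      ∀ a, ¬ 0 ≤ val (mulUp x) + m • val up + val (nim a)) := by
  obtain ⟨n, hn⟩ := hx
  rw [val_mulUp_of_eq hn, hn, val_ofInt_strictMono.le_iff_le, val_ofInt_strictMono.le_iff_le,
    ← add_zsmul]
  exact ⟨fun _ _ => (zsmul_up_add_farStar _).1 (by omega),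
    fun _ _ => (zsmul_up_add_farStar _).2 (by omega),
    fun _ _ a => (zsmul_up_add_nim _ a).1 (by omega),
    fun _ _ a => (zsmul_up_add_nim _ a).2 (by omega)⟩

/-- How the order relation between a game `x` and an integer determines the outcome of
`x · ↑` plus a multiple of `↑`, with a nim-heap or the far star. -/
theorem mulUp_bounds {x : Game} (hx : x.IsShort) (k m : ℤ) :
    (m + k = -1 → val x ≤ val (ofInt k) → val (mulUp x) + m • val up + val farStar ≤ 0) ∧
    (m + k = 1 → ¬ val (ofInt k) ≤ val x →
      ¬ 0 ≤ val (mulUp x) + m • val up + val farStar) ∧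
    (m + k = -2 → val x ≤ val (ofInt k) →
      ∀ a, val (mulUp x) + m • val up + val (nim a) ≤ 0) ∧
    (m + k = 0 → ¬ val (ofInt k) ≤ val x →
      ∀ a, ¬ 0 ≤ val (mulUp x) + m • val up + val (nim a)) := by
  induction x using option_induction generalizing k m with
  | h x xL xR =>
  by_cases hint : ∃ n : ℤ, val x = val (ofInt n)
  · exact mulUp_of_eq_ofInt hint
  have lt_succ : ∀ {k k' : ℤ}, k < k' → val x ≤ val (ofInt k) → ¬ val (ofInt k') ≤ val x :=
    fun hk h hc => (val_ofInt_strictMono hk).not_ge (hc.trans h)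
  -- The clauses with Right to move come first: Right answers in `x · ↑`, which adds ⇓* and lowers
  -- `m` by 2. The other two clauses use them at the same `x`.
  have hβ : ∀ k m : ℤ, m + k = 1 → ¬ val (ofInt k) ≤ val x →
      ¬ 0 ≤ val (mulUp x) + m • val up + val farStar := by
    intro k m hm h
    obtain ⟨x', hx', hle⟩ := exists_rightOption_le_ofInt hint h
    have hs := hx.right hx'
    rw [← val_intMulUp, ← val_add, ← val_add, not_zero_le_val_iff]
    refine ⟨_, (((isRightOption_mulUp hint).2 ⟨x', hx', rfl⟩).add_right _).add_right _, ?_⟩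
    have := (mulUp_add_farStar_add_nim_iff hs (m - 2) 1).1.2
      ((xR x' hx' hs k (m - 2)).1 (by omega) hle)
    convert this using 1
    simp only [val_add, val_down, val_star, val_intMulUp]
    module
  have hδ : ∀ k m : ℤ, m + k = 0 → ¬ val (ofInt k) ≤ val x →
      ∀ a, ¬ 0 ≤ val (mulUp x) + m • val up + val (nim a) := by
    intro k m hm h a
    obtain ⟨x', hx', hle⟩ := exists_rightOption_le_ofInt hint h
    have hs := hx.right hx'
    rw [← val_intMulUp, ← val_add, ← val_add, not_zero_le_val_iff]
    refine ⟨_, (((isRightOption_mulUp hint).2 ⟨x', hx', rfl⟩).add_right _).add_right _, ?_⟩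
    have := (xR x' hx' hs k (m - 2)).2.2.1 (by omega) hle (1 ^^^ a)
    convert this using 1
    rw [← val_nim_add_nim]
    simp only [val_add, val_down, val_star, val_intMulUp]
    module
  refine ⟨fun hm h => ?_, hβ k m, fun hm h a => ?_, hδ k m⟩
  · rw [← val_intMulUp, ← val_add, ← val_add, val_le_zero_iff]
    intro z hz
    rcases isLeftOption_add.1 hz with ⟨y, hy, rfl⟩ | ⟨y, hy, rfl⟩
    · rcases isLeftOption_add.1 hy with ⟨y', hy', rfl⟩ | ⟨y', hy', rfl⟩
      · obtain ⟨x', hx', rfl⟩ := (isLeftOption_mulUp hint).1 hy'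
        have hs := hx.left hx'
        have := (mulUp_add_farStar_add_nim_iff hs (m + 2) 1).2.not.2
          ((xL x' hx' hs k (m + 2)).2.1 (by omega) ((val_le_val_iff.1 h).1 x' hx'))
        convert this using 2
        simp only [val_add, val_star, val_intMulUp]
        module
      · rcases hy'.val_intMulUp with hv | hv
        · rw [val_add, val_add, hv]
          -- The integer bound may be raised freely because x ≤ k; `k + 3` is the value that matches
          -- the coefficient `m - 1`.
          exact hβ (k + 3) (m - 1) (by omega) (lt_succ (by omega) h)
        · have := (mulUp_add_farStar_add_nim_iff hx (m + 1) 1).2.not.2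
            (hβ (k + 1) (m + 1) (by omega) (lt_succ (by omega) h))
          rw [val_add, val_add, hv]
          convert this using 2
          abel
    · obtain ⟨a, rfl⟩ := isLeftOption_farStar.1 hy
      rw [val_add, val_add, val_intMulUp]
      exact hδ (k + 1) m (by omega) (lt_succ (by omega) h) a
  · rw [← val_intMulUp, ← val_add, ← val_add, val_le_zero_iff]
    intro z hz
    rcases isLeftOption_add.1 hz with ⟨y, hy, rfl⟩ | ⟨y, hy, rfl⟩
    · rcases isLeftOption_add.1 hy with ⟨y', hy', rfl⟩ | ⟨y', hy', rfl⟩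
      · obtain ⟨x', hx', rfl⟩ := (isLeftOption_mulUp hint).1 hy'
        have := (xL x' hx' (hx.left hx') k (m + 2)).2.2.2 (by omega)
          ((val_le_val_iff.1 h).1 x' hx') (1 ^^^ a)
        convert this using 2
        rw [← val_nim_add_nim]
        simp only [val_add, val_star, val_intMulUp]
        module
      · rcases hy'.val_intMulUp with hv | hv
        · rw [val_add, val_add, hv]
          exact hδ (k + 3) (m - 1) (by omega) (lt_succ (by omega) h) a
        · rw [val_add, val_add, hv]
          have := hδ (k + 1) (m + 1) (by omega) (lt_succ (by omega) h) (1 ^^^ a)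
          rw [← val_nim_add_nim] at this
          convert this using 2
          abel
    · obtain ⟨b, -, rfl⟩ := isLeftOption_nim.1 hy
      rw [val_add, val_add, val_intMulUp]
      exact hδ (k + 2) m (by omega) (lt_succ (by omega) h) b

theorem ofInt_le_of_zero_le {x : Game} (hx : x.IsShort) {n : ℤ}
    (h : 0 ≤ val (mulUp x) + (1 - n) • val up + val farStar) : val (ofInt n) ≤ val x := by
  by_contra hc
  exact (mulUp_bounds hx n (1 - n)).2.1 (by omega) hc h

theorem le_ofInt_of_le_zero {x : Game} (hx : x.IsShort) {n : ℤ}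
    (h : val (mulUp x) + (-1 - n) • val up + val farStar ≤ 0) : val x ≤ val (ofInt n) := by
  rw [← neg_le_neg_iff, ← val_ofInt_neg, ← val_neg]
  refine ofInt_le_of_zero_le hx.neg ?_
  rw [← neg_nonneg] at h
  convert h using 1
  rw [val_mulUp_neg, neg_add, neg_add, neg_val_farStar]
  congr 2
  module

theorem val_eq_ofInt_of_farStarEquiv {x : Game} (hx : x.IsShort) {n : ℤ}
    (h : FarStarEquiv (mulUp x) (intMulUp n)) : val x = val (ofInt n) := by
  have h' : ∀ m : ℤ, (0 ≤ val (mulUp x) + m • val up + val farStar ↔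
      0 ≤ (n + m) • val up + val farStar) ∧ (val (mulUp x) + m • val up + val farStar ≤ 0 ↔
      (n + m) • val up + val farStar ≤ 0) := by
    intro m
    have := h (intMulUp m) (isShort_intMulUp m)
    rw [outcome_eq_iff] at this
    simpa only [val_add, val_intMulUp, ← add_zsmul] using this
  refine le_antisymm (le_ofInt_of_le_zero hx ((h' _).2.2 ?_))
    (ofInt_le_of_zero_le hx ((h' _).1.2 ?_))
  · exact (zsmul_up_add_farStar _).1 (by omega)
  · have := (zsmul_up_add_farStar (-1)).1 le_rfl
    rw [← neg_nonneg, neg_add, neg_val_farStar, ← neg_zsmul, neg_neg] at this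
    convert this using 3
    omega

end Game

/-! ### Atomic weights of bipass sums -/

open Game

theorem farStarEquiv_congr_right {g h h' : Game} (he : val h = val h') :
    FarStarEquiv g h ↔ FarStarEquiv g h' := by
  refine forall₂_congr fun x _ => ?_
  rw [outcome_eq_iff, outcome_eq_iff]
  simp only [val_add, he]

/-- The multiples `Δ + 1` of ↑ for the mirror image of g and `1 - Δ` for g itself both bring the
total excess to exactly 1, the threshold for Left to win second with ☆. -/
theorem farStarEquiv_intMulUp_bipassSum (g : List Strip) :
    FarStarEquiv (intMulUp (bipassExcess g)) (bipassSum g) := by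
  refine farStarEquiv_of_zero_le (isShort_intMulUp _) (isShort_bipassSum g) ?_ ?_
  · have := zero_le_bipassSum_add_zsmul_up_add_farStar (g := g.map Strip.mirror)
      (m := bipassExcess g + 1) (by rw [bipassExcess_map_mirror]; omega)
    rw [val_bipassSum_map_mirror] at this
    convert this using 2
    rw [val_intMulUp]
    module
  · have := zero_le_bipassSum_add_zsmul_up_add_farStar (g := g)
      (m := 1 - bipassExcess g) (by omega)
    convert this using 2
    rw [val_intMulUp]
    module

/-- Allowing any `x` with the value of the sum covers a single strip, whose game differs from the
one-term sum by an added 0. -/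
theorem hasAtomicWeight_of_val_eq {x : Game} (hx : x.IsShort) (hx' : x.IsAllSmall)
    {g : List Strip} (h : val x = val (bipassSum g)) :
    x.HasAtomicWeight (ofInt (bipassExcess g)) := by
  have he : FarStarEquiv (intMulUp (bipassExcess g)) x :=
    (farStarEquiv_congr_right h).2 (farStarEquiv_intMulUp_bipassSum g)
  refine ⟨hx, hx', isShort_ofInt _, fun y hy => ?_, fun y hy hxy => ?_⟩
  · rw [← he y hy, outcome_eq_iff]
    simp only [val_add, val_mulUp_of_eq rfl, val_intMulUp, and_self]
  · exact equiv_ofInt_iff.2 (val_eq_ofInt_of_farStarEquiv hy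
      fun z hz => (hxy z hz).trans (he z hz).symm)

theorem exists_strip_excess_eq (n : ℤ) : ∃ s : Strip, s.excess = n := by
  obtain ⟨k, rfl | rfl⟩ := n.eq_nat_or_neg
  · exact ⟨Strip.bw (k + 1), Strip.excess_bw_succ k⟩
  · exact ⟨(Strip.bw (k + 1)).mirror, by rw [Strip.mirror_excess, Strip.excess_bw_succ]⟩

end CGT

end

theorem mainTheorem1 :
    (∀ g : List CGT.Strip,
      (CGT.bipassSum g).HasAtomicWeight (CGT.Game.ofInt (CGT.bipassExcess g))) ∧
    (∀ (g : List CGT.Strip) (G : CGT.Game), (CGT.bipassSum g).HasAtomicWeight G →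
      ∃ n : ℤ, G.Equiv (CGT.Game.ofInt n)) ∧
    (∀ n : ℤ, ∃ s : CGT.Strip, s.toGame.HasAtomicWeight (CGT.Game.ofInt n)) := by
  have h : ∀ g : List CGT.Strip,
      (CGT.bipassSum g).HasAtomicWeight (CGT.Game.ofInt (CGT.bipassExcess g)) := fun g =>
    CGT.hasAtomicWeight_of_val_eq (CGT.isShort_bipassSum g) (CGT.isAllSmall_bipassSum g) rfl
  refine ⟨h, fun g G hG => ⟨_, (h g).2.2.2.2 G hG.2.2.1 hG.2.2.2.1⟩, fun n => ?_⟩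
  obtain ⟨s, hs⟩ := CGT.exists_strip_excess_eq n
  refine ⟨s, ?_⟩
  have hs' : CGT.bipassExcess [s] = n := by rw [CGT.bipassExcess_cons, hs]; exact add_zero n
  rw [← hs']
  refine CGT.hasAtomicWeight_of_val_eq s.isShort_toGame s.isAllSmall_toGame ?_
  rw [CGT.bipassSum_cons, CGT.Game.val_add]
  exact (add_zero _).symm
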